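/- Let $E$ be a non-archimedean local field (for instance a $p$-adic field, that is, a finite extension of $\mathbb{Q}_p$), and let $F/E$ be a wildly ramified separable quadratic extension, that is, $[F:E]=2$, $F/E$ is totally ramified, and the residue field of $E$ has characteristic $2$. Let $O_E$, $O_F$ be the rings of integers, $q$ the number of elements of the residue field of $F$ (equivalently of $E$), $v_F$ the normalized valuation of $F$ and $|\cdot|=|\cdot|_F$ the absolute value on $F$ normalized by $|\varpi|=q^{-1}$ for a uniformizer $\varpi$ of $F$. Let $N=N_{F/E}$ be the norm, $x\mapsto\overline{x}$ the non-trivial automorphism of $F/E$, and $s=v_F(\overline{\varpi}\,\varpi^{-1}-1)$, where $\varpi$ is any uniformizer of $F$. Let $dx$ be the Haar measure on $F$ with $\int_{O_F}dx=1$, and let $\chi^*$ be a non-trivial character of $E^*$ that is trivial on $N(F^*)$. Let $\eta\in O_E^*$, and let $z_1,z_2\in\mathbb{C}$ be such that $s_1=-z_1+z_2-\frac12$ satisfies $\mathrm{Re}(s_1)>-\frac12$. Then the integral below converges absolutely, and $$\int_{O_F}|\eta+N(x)|^{s_1}\,dx=\frac{q^{2z_2}-q^{2z_2-1}+\chi^*(-\eta)\left(q^{s(2z_1-2z_2)+2z_1}-q^{(2z_1-2z_2)s+2z_2-1}\right)}{q^{2z_2}-q^{2z_1}}.$$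 -/

import Mathlib

open ValuativeRel MeasureTheory

noncomputable section

namespace LocalFieldIntegral

/-- The normalized discrete valuation `v_K : K → ℤ` of a non-archimedean local field `K`, for which
a uniformizer has valuation `1` and the units of the ring of integers have valuation `0`.
The value at `0` is the junk value `0`. (There is only one isomorphism of ordered groups from the
value group to `ℤ`, so nothing depends on a choice.) -/
def val (K : Type*) [Field K] [ValuativeRel K] [TopologicalSpace K]
    [IsNonarchimedeanLocalField K] (x : K) : ℤ :=
  -WithZero.log (IsNonarchimedeanLocalField.valueGroupWithZeroIsoInt K (valuation K x))

/-- The number `q_K` of elements of the residue field of `K`. -/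
def resCard (K : Type*) [Field K] [ValuativeRel K] [TopologicalSpace K]
    [IsNonarchimedeanLocalField K] : ℕ :=
  Nat.card 𝓀[K]

open scoped Classical in
/-- The normalized absolute value `|x|_K = q_K ^ (-v_K(x))` of `K`, with `|0|_K = 0`. -/
def absVal (K : Type*) [Field K] [ValuativeRel K] [TopologicalSpace K]
    [IsNonarchimedeanLocalField K] (x : K) : ℝ :=
  if x = 0 then 0 else (resCard K : ℝ) ^ (-val K x)

/-- `F / E` is a wildly ramified quadratic extension: the degree is `2`, the extension is totally
ramified (a uniformizer of `E` has valuation `[F : E]` in `F`), and the residue characteristic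
is `2`. -/
structure IsWildlyRamifiedQuadratic (E F : Type*) [Field E] [ValuativeRel E] [TopologicalSpace E]
    [IsNonarchimedeanLocalField E] [Field F] [ValuativeRel F] [TopologicalSpace F]
    [IsNonarchimedeanLocalField F] [Algebra E F] : Prop where
  finrank_eq_two : Module.finrank E F = 2
  totallyRamified : ∀ π : E, val E π = 1 → val F (algebraMap E F π) = Module.finrank E F
  charP_residueField : CharP 𝓀[E] 2

/-- `χ` is a non-trivial character of `Eˣ` that is trivial on the norms from `Fˣ`. -/
def IsNormCharacter (E F : Type*) [Field E] [Field F] [Algebra E F] (χ : Eˣ →* ℂˣ) : Prop :=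
  χ ≠ 1 ∧ ∀ y : Fˣ, χ (Units.map (Algebra.norm E : F →* E) y) = 1

end LocalFieldIntegral

end

/-! The integrand depends only on the valuation of η + N(x). Let A_n be the set of x in O_F with
N(x) ≡ -η modulo p_E^n; all valuations are taken in F, so this reads "valuation at least 2n". On A_n
\ A_{n+1} the integrand is (uq)^n with u = q^(2z₁-2z₂), and Re(s₁) > -1/2 says exactly that |u| < 1.
Everything therefore rests on vol(A_n), which is q^(-n) for n ≤ s and (1 + χ(-η)) q^(-n) for n > s;
summing the series gives the formula.

The volumes come from refining A_n into q subfibres over the classes modulo p_E^(n+1).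
Multiplication by a unit v preserves Haar measure and carries the fibre over c to the fibre over
N(v)c, so what matters is which 1 + tπ^n, with π = N(ϖ), are norms modulo p_E^(n+1). Here N(1 + ay)
= 1 + a Tr(y) + a² N(y) for a in E. Below the break s the quadratic term dominates and squaring is
onto the residue field; above s the linear trace term dominates; in both cases all q subfibres have
equal volume (`measure_normFiber_eq_mul_succ`). At n = s the two terms balance into a ↦ a² + βa,
with kernel of order 2 and image of index 2, so half of the subfibres over a norm are empty
(`two_mul_measure_normFiber_break`).

Index two also shows that a product of two non-norm units is a norm (`exists_norm_eq_mul`), so χ is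
1 on norm units and -1 on the others. Class field theory is not needed: the given χ itself supplies
a non-norm unit. -/

noncomputable section

namespace LocalFieldIntegral

open WithZero

/-! ### Valuation, fractional ideals and reduction in a local field -/

section Basic

variable (K : Type*) [Field K] [ValuativeRel K] [TopologicalSpace K]
  [IsNonarchimedeanLocalField K]

/-- The valuation of a local field with values in `ℤᵐ⁰`. -/
def intValuation : Valuation K (WithZero (Multiplicative ℤ)) :=
  (valuation K).map (IsNonarchimedeanLocalField.valueGroupWithZeroIsoInt K).toMonoidWithZeroHom
    (OrderIsoClass.toOrderIso (IsNonarchimedeanLocalField.valueGroupWithZeroIsoInt K)).monotone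

lemma intValuation_apply (x : K) : intValuation K x =
    IsNonarchimedeanLocalField.valueGroupWithZeroIsoInt K (valuation K x) := rfl

/-- The fractional ideal of elements of valuation at least `n`. -/
def valGE (n : ℤ) : AddSubgroup K where
  carrier := {x | intValuation K x ≤ exp (-n)}
  zero_mem' := by simp
  add_mem' := fun {a b} ha hb ↦ by
    rw [Set.mem_ofPred_eq] at ha hb ⊢
    exact (Valuation.map_add _ a b).trans (max_le ha hb)
  neg_mem' := fun {a} ha ↦ by simpa using ha

variable {K}

lemma intValuation_eq {x : K} (hx : x ≠ 0) : intValuation K x = exp (-val K x) := by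
  rw [val, neg_neg, ← intValuation_apply, exp_log]
  simpa using hx

lemma mem_valGE_iff_le {n : ℤ} {x : K} : x ∈ valGE K n ↔ intValuation K x ≤ exp (-n) := by
  change x ∈ {x | intValuation K x ≤ exp (-n)} ↔ _
  rw [Set.mem_ofPred_eq]

lemma mem_valGE {n : ℤ} {x : K} (hx : x ≠ 0) : x ∈ valGE K n ↔ n ≤ val K x := by
  rw [mem_valGE_iff_le, intValuation_eq hx, exp_le_exp, neg_le_neg_iff]

lemma val_eq_iff {n : ℤ} {x : K} (hx : x ≠ 0) : val K x = n ↔ intValuation K x = exp (-n) := by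
  rw [intValuation_eq hx, exp_inj, neg_inj]

lemma val_mul {x y : K} (hx : x ≠ 0) (hy : y ≠ 0) : val K (x * y) = val K x + val K y := by
  rw [val_eq_iff (mul_ne_zero hx hy), map_mul, intValuation_eq hx, intValuation_eq hy, ← exp_add]
  congr 1; ring

@[simp] lemma val_zero : val K (0 : K) = 0 := by simp [val]

@[simp] lemma val_one : val K (1 : K) = 0 := by simp [val]

@[simp] lemma val_neg (x : K) : val K (-x) = val K x := by simp [val]

@[simp] lemma val_inv (x : K) : val K x⁻¹ = -val K x := by simp [val]

lemma val_div {x y : K} (hx : x ≠ 0) (hy : y ≠ 0) : val K (x / y) = val K x - val K y := by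
  rw [div_eq_mul_inv, val_mul hx (inv_ne_zero hy), val_inv, sub_eq_add_neg]

lemma val_pow (x : K) (n : ℕ) : val K (x ^ n) = n * val K x := by
  simp [val]

lemma valGE_anti {m n : ℤ} (h : m ≤ n) : valGE K n ≤ valGE K m := fun _ hx ↦
  mem_valGE_iff_le.2 ((mem_valGE_iff_le.1 hx).trans (exp_le_exp.2 (neg_le_neg h)))

lemma mul_mem_valGE {m n : ℤ} {x y : K} (hx : x ∈ valGE K m) (hy : y ∈ valGE K n) :
    x * y ∈ valGE K (m + n) := by
  rw [mem_valGE_iff_le, map_mul, neg_add, exp_add]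
  exact mul_le_mul' (mem_valGE_iff_le.1 hx) (mem_valGE_iff_le.1 hy)

lemma self_mem_valGE (x : K) : x ∈ valGE K (val K x) := by
  by_cases hx : x = 0
  · subst hx; exact zero_mem _
  · exact (mem_valGE hx).2 le_rfl

lemma mem_valGE_of_val {n : ℤ} {x : K} (h : n ≤ val K x) : x ∈ valGE K n :=
  valGE_anti h (self_mem_valGE x)

lemma one_mem_valGE : (1 : K) ∈ valGE K 0 := mem_valGE_of_val (by simp)

lemma ne_zero_of_val {x : K} (h : val K x ≠ 0) : x ≠ 0 := fun h0 ↦ h (by simp [h0])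

lemma add_ne_zero_and_val {x y : K} (hx : x ≠ 0) (hy : y ∈ valGE K (val K x + 1)) :
    x + y ≠ 0 ∧ val K (x + y) = val K x := by
  have hlt : intValuation K y < intValuation K x := by
    rw [intValuation_eq hx]
    exact lt_of_le_of_lt (mem_valGE_iff_le.1 hy) (exp_lt_exp.2 (by omega))
  have h := Valuation.map_add_eq_of_lt_left _ hlt
  have h0 : x + y ≠ 0 := by
    intro h0
    rw [h0, map_zero] at h
    exact hx ((map_eq_zero _).1 h.symm)
  refine ⟨h0, ?_⟩
  rw [val_eq_iff h0, ← intValuation_eq hx, h]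

lemma val_add_eq {x y : K} (hx : x ≠ 0) (hy : y ∈ valGE K (val K x + 1)) :
    val K (x + y) = val K x := (add_ne_zero_and_val hx hy).2

lemma mem_integer_iff {x : K} : x ∈ 𝒪[K] ↔ x ∈ valGE K 0 := by
  rw [mem_valGE_iff_le, neg_zero, exp_zero, Valuation.mem_integer_iff, intValuation_apply,
    ← map_one (IsNonarchimedeanLocalField.valueGroupWithZeroIsoInt K), OrderIsoClass.map_le_map_iff]

lemma coe_integer_eq : (𝒪[K] : Set K) = (valGE K 0 : Set K) := Set.ext fun _ ↦ mem_integer_iff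

lemma exists_val_eq (n : ℤ) : ∃ x : K, x ≠ 0 ∧ val K x = n := by
  obtain ⟨x, hx⟩ := ValuativeRel.valuation_surjective
    ((IsNonarchimedeanLocalField.valueGroupWithZeroIsoInt K).symm (exp (-n)))
  have hx' : intValuation K x = exp (-n) := by simp [intValuation_apply, hx]
  have h0 : x ≠ 0 := by rintro rfl; rw [map_zero] at hx'; exact exp_ne_zero hx'.symm
  exact ⟨x, h0, (val_eq_iff h0).2 hx'⟩

lemma isOpen_valGE (n : ℤ) : IsOpen (valGE K n : Set K) := by
  obtain ⟨z, hz, hn⟩ := exists_val_eq (K := K) (n - 1)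
  apply AddSubgroup.isOpen_of_mem_nhds (g := 0)
  rw [IsValuativeTopology.mem_nhds_zero_iff]
  refine ⟨Units.mk0 (valuation K z) (by simpa using hz), fun x hx ↦ ?_⟩
  by_cases hx0 : x = 0
  · subst hx0; exact zero_mem _
  have hx' : valuation K x < valuation K z := hx
  have : intValuation K x < intValuation K z := by
    rw [intValuation_apply, intValuation_apply]
    exact (IsNonarchimedeanLocalField.valueGroupWithZeroIsoInt K).strictMono hx'
  rw [intValuation_eq hx0, intValuation_eq hz, exp_lt_exp] at this
  exact (mem_valGE hx0).2 (by omega)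

lemma isCompact_valGE_zero : IsCompact (valGE K 0 : Set K) := by
  rw [← coe_integer_eq]
  exact IsNonarchimedeanLocalField.isCompact_closedBall K 1

lemma eq_zero_of_forall_mem_valGE {x : K} (h : ∀ n : ℕ, x ∈ valGE K n) : x = 0 := by
  by_contra hx
  have := (mem_valGE hx).1 (h (val K x + 1).toNat)
  omega

lemma inv_mem_valGE {x : K} {n : ℤ} (hn : n ≤ -val K x) : x⁻¹ ∈ valGE K n :=
  mem_valGE_of_val (by simpa using hn)

lemma mul_mem_valGE_iff {x y : K} (hx : x ≠ 0) {n : ℤ} :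
    x * y ∈ valGE K n ↔ y ∈ valGE K (n - val K x) := by
  by_cases hy : y = 0
  · simp [hy]
  rw [mem_valGE (mul_ne_zero hx hy), mem_valGE hy, val_mul hx hy]
  omega

/-- The reduction of an element, with junk value `0` outside of the ring of integers. -/
def red (x : K) : 𝓀[K] := by
  classical exact if h : x ∈ 𝒪[K] then IsLocalRing.residue 𝒪[K] ⟨x, h⟩ else 0

lemma red_of_mem {x : K} (h : x ∈ 𝒪[K]) : red x = IsLocalRing.residue 𝒪[K] ⟨x, h⟩ := dif_pos h

lemma red_add {x y : K} (hx : x ∈ valGE K 0) (hy : y ∈ valGE K 0) :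
    red (x + y) = red x + red y := by
  rw [← mem_integer_iff] at hx hy
  rw [red_of_mem hx, red_of_mem hy, red_of_mem (add_mem hx hy), ← map_add]
  rfl

lemma red_mul {x y : K} (hx : x ∈ valGE K 0) (hy : y ∈ valGE K 0) :
    red (x * y) = red x * red y := by
  rw [← mem_integer_iff] at hx hy
  rw [red_of_mem hx, red_of_mem hy, red_of_mem (mul_mem hx hy), ← map_mul]
  rfl

lemma red_one : red (1 : K) = 1 := by
  rw [red_of_mem (one_mem _)]
  exact map_one (IsLocalRing.residue 𝒪[K])

lemma exists_red_eq (t : 𝓀[K]) : ∃ x ∈ valGE K 0, red x = t := by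
  obtain ⟨⟨x, hx⟩, rfl⟩ := IsLocalRing.residue_surjective t
  exact ⟨x, mem_integer_iff.1 hx, red_of_mem hx⟩

lemma red_eq_zero_iff {x : K} (hx : x ∈ valGE K 0) : red x = 0 ↔ x ∈ valGE K 1 := by
  have hx' := mem_integer_iff.2 hx
  rw [red_of_mem hx', IsLocalRing.residue_eq_zero_iff, IsLocalRing.mem_maximalIdeal,
    mem_nonunits_iff]
  by_cases h0 : x = 0
  · subst h0
    simp only [zero_mem, iff_true]
    exact fun h ↦ not_isUnit_zero (M₀ := 𝒪[K]) h
  rw [mem_valGE h0]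
  rw [mem_valGE h0] at hx
  constructor
  · intro h
    by_contra hlt
    have hv : val K x = 0 := by omega
    have hi : x⁻¹ ∈ 𝒪[K] := mem_integer_iff.2 (inv_mem_valGE (by omega))
    exact h (IsUnit.of_mul_eq_one ⟨x⁻¹, hi⟩ (Subtype.ext (mul_inv_cancel₀ h0)))
  · intro h hu
    obtain ⟨⟨y, hy⟩, hxy⟩ := hu.exists_right_inv
    have hxy' : x * y = 1 := congrArg Subtype.val hxy
    have hy0 : y ≠ 0 := by rintro rfl; simp at hxy'
    have := val_mul h0 hy0
    rw [hxy', val_one] at this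
    have := (mem_valGE hy0).1 (mem_integer_iff.1 hy)
    omega

lemma red_sub {x y : K} (hx : x ∈ valGE K 0) (hy : y ∈ valGE K 0) :
    red (x - y) = red x - red y := by
  have := red_add (sub_mem hx hy) hy
  rw [sub_add_cancel] at this
  rw [this, add_sub_cancel_right]

lemma red_eq_red_iff {x y : K} (hx : x ∈ valGE K 0) (hy : y ∈ valGE K 0) :
    red x = red y ↔ x - y ∈ valGE K 1 := by
  rw [← red_eq_zero_iff (sub_mem hx hy), red_sub hx hy, sub_eq_zero]

end Basic

/-! ### Ramified involutions and their ramification break -/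

/-- An involution `σ` of a local field whose fixed field `E` is such that the extension is ramified
quadratic with residue characteristic `2`, expressed inside the large field. -/
structure IsRamifiedInvolution {F : Type*} [Field F] [ValuativeRel F] [TopologicalSpace F]
    [IsNonarchimedeanLocalField F] (σ : F ≃+* F) (ϖ : F) : Prop where
  invol : ∀ x, σ (σ x) = x
  even : ∀ x, σ x = x → Even (val F x)
  decomp : ∀ x, ∃ a b, σ a = a ∧ σ b = b ∧ x = a + b * ϖ
  unif : val F ϖ = 1
  two_mem : (2 : F) ∈ valGE F 1

namespace IsRamifiedInvolution

variable {F : Type*} [Field F] [ValuativeRel F] [TopologicalSpace F]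
  [IsNonarchimedeanLocalField F] {σ : F ≃+* F} {ϖ : F}

section

variable (h : IsRamifiedInvolution σ ϖ)
include h

lemma unif_ne_zero : ϖ ≠ 0 := ne_zero_of_val (by rw [h.unif]; exact one_ne_zero)

lemma norm_fixed (x : F) : σ (x * σ x) = x * σ x := by rw [map_mul, h.invol, mul_comm]

lemma trace_fixed (x : F) : σ (x + σ x) = x + σ x := by rw [map_add, h.invol, add_comm]

/-- The norm and trace of `ϖ` are fixed, hence of even valuation. The norm forces `σ ϖ` to have odd
valuation; if this were not 1, the trace would have the smaller of two distinct odd valuations. -/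
lemma val_conj_unif : val F (σ ϖ) = 1 := by
  have h0 := h.unif_ne_zero
  have h0' : σ ϖ ≠ 0 := by simpa using h0
  have hu := h.unif
  obtain ⟨m, hm⟩ := h.even _ (h.norm_fixed ϖ)
  obtain ⟨n, hn⟩ := h.even _ (h.trace_fixed ϖ)
  rw [val_mul h0 h0', hu] at hm
  by_contra hne
  rcases lt_or_gt_of_ne hne with hlt | hlt
  · rw [add_comm, val_add_eq h0' (mem_valGE_of_val (by omega))] at hn
    omega
  · rw [val_add_eq h0 (mem_valGE_of_val (by omega))] at hn
    omega

/-- In `a + b * ϖ` with fixed nonzero `a`, `b` the summands have valuations of opposite parity, so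
nothing cancels, and the same holds after conjugation. -/
lemma val_conj (x : F) : val F (σ x) = val F x := by
  obtain ⟨a, b, ha, hb, rfl⟩ := h.decomp x
  have h0 := h.unif_ne_zero
  have h0' : σ ϖ ≠ 0 := by simpa using h0
  have hu := h.unif
  have hu' := h.val_conj_unif
  rw [map_add, map_mul, ha, hb]
  by_cases hb0 : b = 0
  · simp [hb0]
  have h1 := val_mul hb0 h0
  have h2 := val_mul hb0 h0'
  by_cases ha0 : a = 0
  · simp only [ha0, zero_add]; omega
  obtain ⟨m, hm⟩ := h.even _ ha
  obtain ⟨n, hn⟩ := h.even _ hb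
  rcases lt_or_gt_of_ne (show val F a ≠ val F (b * ϖ) by omega) with hlt | hlt
  · rw [val_add_eq ha0 (mem_valGE_of_val (by omega)), val_add_eq ha0 (mem_valGE_of_val (by omega))]
  · rw [add_comm, val_add_eq (mul_ne_zero hb0 h0') (mem_valGE_of_val (by omega)), add_comm a,
      val_add_eq (mul_ne_zero hb0 h0) (mem_valGE_of_val (by omega))]
    omega

lemma conj_mem {x : F} {n : ℤ} (hx : x ∈ valGE F n) : σ x ∈ valGE F n := by
  by_cases hx0 : x = 0
  · simp [hx0, zero_mem]
  · exact mem_valGE_of_val (by rw [h.val_conj]; exact (mem_valGE hx0).1 hx)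

lemma fixed_mem_succ {x : F} (hx : σ x = x) {n : ℤ} (hn : Odd n) (hm : x ∈ valGE F n) :
    x ∈ valGE F (n + 1) := by
  by_cases hx0 : x = 0
  · simp [hx0, zero_mem]
  obtain ⟨k, hk⟩ := h.even x hx
  obtain ⟨l, hl⟩ := hn
  have := (mem_valGE hx0).1 hm
  exact mem_valGE_of_val (by omega)

lemma decomp_mem {x : F} (hx : x ∈ valGE F 0) :
    ∃ a b, σ a = a ∧ σ b = b ∧ a ∈ valGE F 0 ∧ b ∈ valGE F 0 ∧ x = a + b * ϖ := by
  obtain ⟨a, b, ha, hb, rfl⟩ := h.decomp x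
  refine ⟨a, b, ha, hb, ?_⟩
  have h0 := h.unif_ne_zero
  have hu := h.unif
  by_cases hb0 : b = 0
  · subst hb0; simp only [zero_mul, add_zero] at hx; simp [zero_mem, hx]
  have h1 := val_mul hb0 h0
  obtain ⟨n, hn⟩ := h.even _ hb
  by_cases ha0 : a = 0
  · subst ha0; simp only [zero_add] at hx
    have := (mem_valGE (mul_ne_zero hb0 h0)).1 hx
    exact ⟨zero_mem _, mem_valGE_of_val (by omega), rfl⟩
  obtain ⟨m, hm⟩ := h.even _ ha
  rcases lt_or_gt_of_ne (show val F a ≠ val F (b * ϖ) by omega) with hlt | hlt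
  · obtain ⟨h2, h3⟩ := add_ne_zero_and_val ha0 (y := b * ϖ) (mem_valGE_of_val (by omega))
    have := (mem_valGE h2).1 hx
    exact ⟨mem_valGE_of_val (by omega), mem_valGE_of_val (by omega), rfl⟩
  · obtain ⟨h2, h3⟩ := add_ne_zero_and_val (mul_ne_zero hb0 h0) (y := a)
      (mem_valGE_of_val (by omega))
    rw [add_comm] at h2 h3
    have := (mem_valGE h2).1 hx
    exact ⟨mem_valGE_of_val (by omega), mem_valGE_of_val (by omega), rfl⟩

/-- Total ramification: the fixed field already has the full residue field, because `b * ϖ` reduces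
to zero. -/
lemma exists_fixed_red_eq (t : 𝓀[F]) : ∃ a, σ a = a ∧ a ∈ valGE F 0 ∧ red a = t := by
  obtain ⟨x, hx, rfl⟩ := exists_red_eq t
  obtain ⟨a, b, ha, hb, ha', hb', rfl⟩ := h.decomp_mem hx
  refine ⟨a, ha, ha', ?_⟩
  have hb1 : b * ϖ ∈ valGE F 1 := by
    have := mul_mem_valGE hb' (self_mem_valGE ϖ)
    rwa [h.unif, zero_add] at this
  have := (red_eq_zero_iff (valGE_anti zero_le_one hb1)).2 hb1
  rw [red_add ha' (valGE_anti zero_le_one hb1), this, add_zero]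

lemma charTwo : CharP 𝓀[F] 2 := by
  have h2 : (2 : 𝓀[F]) = 0 := by
    have h1 := (red_eq_zero_iff (valGE_anti zero_le_one h.two_mem)).2 h.two_mem
    rw [← one_add_one_eq_two, red_add one_mem_valGE one_mem_valGE, red_one] at h1
    rw [← one_add_one_eq_two, h1]
  exact CharTwo.of_one_ne_zero_of_two_eq_zero one_ne_zero h2

lemma fixed_sub_mem_two {a b : F} (ha : σ a = a) (hb : σ b = b) (ha' : a ∈ valGE F 0)
    (hb' : b ∈ valGE F 0) (hab : red a = red b) : a - b ∈ valGE F 2 :=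
  h.fixed_mem_succ (by rw [map_sub, ha, hb]) odd_one ((red_eq_red_iff ha' hb').1 hab)

/-- Since the residue field is perfect of characteristic `2`, every integral fixed element is
congruent to the square of another one. -/
lemma exists_sq_sub_mem {t : F} (ht : σ t = t) (ht' : t ∈ valGE F 0) :
    ∃ a, σ a = a ∧ a ∈ valGE F 0 ∧ a * a - t ∈ valGE F 2 := by
  have := h.charTwo
  have : Fintype 𝓀[F] := Fintype.ofFinite _
  obtain ⟨r, hr⟩ := (FiniteField.isSquare_of_char_two (ringChar.eq 𝓀[F] 2) (red t))
  obtain ⟨a, ha, ha', rfl⟩ := h.exists_fixed_red_eq r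
  have ha2 : a * a ∈ valGE F 0 := by simpa using mul_mem_valGE ha' ha'
  exact ⟨a, ha, ha', h.fixed_sub_mem_two (by rw [map_mul, ha]) ht ha2 ht'
    (by rw [red_mul ha' ha', hr])⟩

/-! ### The ramification break -/

lemma break_ne_zero : σ ϖ * ϖ⁻¹ - 1 ≠ 0 := by
  have h0 := h.unif_ne_zero
  intro h1
  rw [sub_eq_zero, mul_inv_eq_one₀ h0] at h1
  obtain ⟨k, hk⟩ := h.even _ h1
  rw [h.unif] at hk
  omega

lemma trace_unif : ϖ + σ ϖ = ϖ * (2 + (σ ϖ * ϖ⁻¹ - 1)) := by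
  have h0 := h.unif_ne_zero
  field_simp
  ring

variable {s : ℕ} (hs : val F (σ ϖ * ϖ⁻¹ - 1) = s)
include hs

/-- The trace of `ϖ` is `ϖ * (2 + δ)`, where δ = `σ ϖ * ϖ⁻¹ - 1` has valuation `s`. If 2 had
valuation below `s`, the trace would have odd valuation. The same parity test drives the next three
lemmas. -/
lemma two_mem_break : (2 : F) ∈ valGE F s := by
  have h0 := h.unif_ne_zero
  by_cases h20 : (2 : F) = 0
  · rw [h20]; exact zero_mem _
  by_contra hlt
  rw [mem_valGE h20] at hlt
  obtain ⟨k, hk⟩ := h.even 2 (map_ofNat σ 2)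
  obtain ⟨m, hm⟩ := h.even _ (h.trace_fixed ϖ)
  obtain ⟨h1, h2⟩ := add_ne_zero_and_val h20 (y := σ ϖ * ϖ⁻¹ - 1) (mem_valGE_of_val (by omega))
  rw [h.trace_unif, val_mul h0 h1, h2, h.unif] at hm
  omega

lemma one_le_break : 1 ≤ s := by
  by_contra hlt
  obtain rfl : s = 0 := by omega
  have h0 := h.unif_ne_zero
  obtain ⟨m, hm⟩ := h.even _ (h.trace_fixed ϖ)
  obtain ⟨h1, h2⟩ := add_ne_zero_and_val (y := 2) h.break_ne_zero
    (by rw [hs]; exact h.two_mem)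
  rw [h.trace_unif, add_comm 2, val_mul h0 h1, h2, h.unif, hs] at hm
  simp at hm
  omega

lemma two_mem_of_odd (hodd : Odd s) : (2 : F) ∈ valGE F (s + 1) :=
  h.fixed_mem_succ (x := 2) (map_ofNat σ 2) (by exact_mod_cast hodd) (h.two_mem_break hs)

lemma val_two_of_even (heven : Even s) : (2 : F) ≠ 0 ∧ val F 2 = s := by
  have h0 := h.unif_ne_zero
  have hmem := h.two_mem_break hs
  obtain ⟨l, hl⟩ := heven
  by_contra hne
  have hmem' : (2 : F) ∈ valGE F (s + 1) := by
    by_cases h20 : (2 : F) = 0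
    · rw [h20]; exact zero_mem _
    · rw [mem_valGE h20] at hmem ⊢
      have : val F 2 ≠ s := fun hh ↦ hne ⟨h20, hh⟩
      omega
  obtain ⟨m, hm⟩ := h.even _ (h.trace_fixed ϖ)
  obtain ⟨h1, h2⟩ := add_ne_zero_and_val (y := 2) h.break_ne_zero (by rw [hs]; exact hmem')
  rw [h.trace_unif, add_comm 2, val_mul h0 h1, h2, h.unif, hs] at hm
  omega

end

/-- An element of valuation `n` with norm `(ϖ * σ ϖ) ^ n`. -/
def twist (σ : F ≃+* F) (ϖ : F) (n : ℕ) : F := (ϖ * σ ϖ) ^ (n / 2) * ϖ ^ (n % 2)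

section

variable (h : IsRamifiedInvolution σ ϖ)
include h

lemma norm_unif_ne_zero : ϖ * σ ϖ ≠ 0 :=
  mul_ne_zero h.unif_ne_zero (by simpa using h.unif_ne_zero)

lemma val_norm_unif : val F (ϖ * σ ϖ) = 2 := by
  rw [val_mul h.unif_ne_zero (by simpa using h.unif_ne_zero), h.val_conj, h.unif]
  norm_num

lemma norm_unif_pow_fixed (n : ℕ) : σ ((ϖ * σ ϖ) ^ n) = (ϖ * σ ϖ) ^ n := by
  rw [map_pow, h.norm_fixed]

lemma val_norm_unif_pow (n : ℕ) : val F ((ϖ * σ ϖ) ^ n) = 2 * n := by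
  rw [val_pow, h.val_norm_unif, mul_comm]

lemma val_twist (n : ℕ) : val F (twist σ ϖ n) = n := by
  rw [twist, val_mul (pow_ne_zero _ h.norm_unif_ne_zero) (pow_ne_zero _ h.unif_ne_zero),
    h.val_norm_unif_pow, val_pow, h.unif]
  omega

lemma norm_twist (n : ℕ) : twist σ ϖ n * σ (twist σ ϖ n) = (ϖ * σ ϖ) ^ n := by
  rw [twist, map_mul, h.norm_unif_pow_fixed, map_pow]
  calc _ = (ϖ * σ ϖ) ^ (2 * (n / 2) + n % 2) := by ring
    _ = _ := by rw [Nat.div_add_mod]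

variable {s : ℕ} (hs : val F (σ ϖ * ϖ⁻¹ - 1) = s)
include hs

lemma trace_twist_mem (n : ℕ) : twist σ ϖ n + σ (twist σ ϖ n) ∈ valGE F (n + s) := by
  have hp := self_mem_valGE ((ϖ * σ ϖ) ^ (n / 2))
  rw [h.val_norm_unif_pow] at hp
  rw [twist, map_mul, h.norm_unif_pow_fixed, map_pow, ← mul_add]
  rcases Nat.mod_two_eq_zero_or_one n with hn | hn
  · rw [hn, pow_zero, pow_zero, one_add_one_eq_two]
    exact valGE_anti (by omega) (mul_mem_valGE hp (h.two_mem_break hs))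
  · rw [hn, pow_one, pow_one, h.trace_unif]
    have h1 : σ ϖ * ϖ⁻¹ - 1 ∈ valGE F s := hs ▸ self_mem_valGE _
    have h2 := self_mem_valGE ϖ
    rw [h.unif] at h2
    exact valGE_anti (by omega)
      (mul_mem_valGE hp (mul_mem_valGE h2 (add_mem (h.two_mem_break hs) h1)))

/-- Matching parity makes the trace bound sharp: for even `s` the trace is twice a fixed element and
2 has valuation `s`; for odd `s` the term 2 is negligible against δ in 2 + δ. -/
lemma trace_twist_val {n : ℕ} (hn : n % 2 = s % 2) :
    twist σ ϖ n + σ (twist σ ϖ n) ≠ 0 ∧ val F (twist σ ϖ n + σ (twist σ ϖ n)) = n + s := by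
  have hp := h.val_norm_unif_pow (n / 2)
  have hp0 : (ϖ * σ ϖ) ^ (n / 2) ≠ 0 := pow_ne_zero _ h.norm_unif_ne_zero
  rw [twist, map_mul, h.norm_unif_pow_fixed, map_pow, ← mul_add]
  rcases Nat.mod_two_eq_zero_or_one n with hn' | hn'
  · obtain ⟨h1, h2⟩ := h.val_two_of_even hs (Nat.even_iff.2 (by omega))
    rw [hn', pow_zero, pow_zero, one_add_one_eq_two]
    refine ⟨mul_ne_zero hp0 h1, ?_⟩
    rw [val_mul hp0 h1, hp, h2]
    omega
  · obtain ⟨h1, h2⟩ := add_ne_zero_and_val (y := 2) h.break_ne_zero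
      (by rw [hs]; exact h.two_mem_of_odd hs (Nat.odd_iff.2 (by omega)))
    have h0 := h.unif_ne_zero
    rw [hn', pow_one, pow_one, h.trace_unif, add_comm 2]
    refine ⟨mul_ne_zero hp0 (mul_ne_zero h0 h1), ?_⟩
    rw [val_mul hp0 (mul_ne_zero h0 h1), val_mul h0 h1, h2, hp, hs, h.unif]
    omega

end

end IsRamifiedInvolution

/-- The integral elements whose norm is congruent to `c` modulo elements of valuation `2 * n`. -/
def normFiber {F : Type*} [Field F] [ValuativeRel F] [TopologicalSpace F]
    [IsNonarchimedeanLocalField F] (σ : F ≃+* F) (n : ℕ) (c : F) : Set F :=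
  {x | x ∈ valGE F 0 ∧ x * σ x - c ∈ valGE F (2 * n)}

/-! ### Norm fibres: which units are norms, and to what precision -/

namespace IsRamifiedInvolution

lemma norm_one_add_mul {F : Type*} [Field F] {σ : F ≃+* F} {a y : F} (ha : σ a = a) :
    (1 + a * y) * σ (1 + a * y) = 1 + a * (y + σ y) + a * a * (y * σ y) := by
  rw [map_add, map_mul, map_one, ha]
  ring

lemma fixed_div {F : Type*} [Field F] {σ : F ≃+* F} {a b : F} (ha : σ a = a) (hb : σ b = b) :
    σ (a / b) = a / b := by
  rw [map_div₀, ha, hb]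

variable {F : Type*} [Field F] [ValuativeRel F] [TopologicalSpace F]
  [IsNonarchimedeanLocalField F] {σ : F ≃+* F} {ϖ : F}

lemma mem_normFiber {n : ℕ} {c x : F} :
    x ∈ normFiber σ n c ↔ x ∈ valGE F 0 ∧ x * σ x - c ∈ valGE F (2 * n) := by
  rw [normFiber, Set.mem_ofPred_eq]

lemma normFiber_anti {m n : ℕ} (hmn : m ≤ n) (c : F) : normFiber σ n c ⊆ normFiber σ m c := by
  intro x hx
  rw [mem_normFiber] at hx ⊢
  exact ⟨hx.1, valGE_anti (by omega) hx.2⟩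

lemma normFiber_congr {n : ℕ} {c d : F} (hcd : c - d ∈ valGE F (2 * n)) :
    normFiber σ n c = normFiber σ n d := by
  ext x
  rw [mem_normFiber, mem_normFiber]
  refine and_congr_right fun _ ↦ ⟨fun hx ↦ ?_, fun hx ↦ ?_⟩
  · simpa using add_mem hx hcd
  · simpa using sub_mem hx hcd

section

variable (h : IsRamifiedInvolution σ ϖ)
include h

lemma mul_mem_normFiber {n : ℕ} {c d x y : F} (hc : c ∈ valGE F 0) (hx : x ∈ normFiber σ n c)
    (hy : y ∈ normFiber σ n d) : x * y ∈ normFiber σ n (c * d) := by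
  rw [mem_normFiber] at hx hy ⊢
  refine ⟨by simpa using mul_mem_valGE hx.1 hy.1, ?_⟩
  have h1 : y * σ y ∈ valGE F 0 := by simpa using mul_mem_valGE hy.1 (h.conj_mem hy.1)
  have h2 := mul_mem_valGE hx.2 h1
  have h3 := mul_mem_valGE hc hy.2
  rw [add_zero] at h2
  rw [zero_add] at h3
  convert add_mem h2 h3 using 1
  rw [map_mul]
  ring

lemma add_mem_normFiber {n : ℕ} {c x y : F} (hx : x ∈ normFiber σ n c)
    (hy : y ∈ valGE F (2 * n)) : x + y ∈ normFiber σ n c := by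
  rw [mem_normFiber] at hx ⊢
  have hy0 : y ∈ valGE F 0 := valGE_anti (by omega) hy
  refine ⟨add_mem hx.1 hy0, ?_⟩
  have h1 := mul_mem_valGE hx.1 (h.conj_mem hy)
  have h2 := mul_mem_valGE hy (h.conj_mem (add_mem hx.1 hy0))
  rw [zero_add] at h1
  rw [add_zero] at h2
  convert add_mem (add_mem hx.2 h1) h2 using 1
  rw [map_add]
  ring

lemma isOpen_normFiber (n : ℕ) (c : F) : IsOpen (normFiber σ n c) := by
  have hop : IsOpen (valGE F (2 * n) : Set F) := isOpen_valGE _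
  rw [isOpen_iff_mem_nhds]
  intro x hx
  have h1 : IsOpen ((fun z ↦ z - x) ⁻¹' (valGE F (2 * n) : Set F)) :=
    hop.preimage (continuous_id.sub continuous_const)
  refine Filter.mem_of_superset (h1.mem_nhds (by simp [zero_mem])) fun z hz ↦ ?_
  simpa using h.add_mem_normFiber hx hz

lemma isClosed_normFiber (n : ℕ) (c : F) : IsClosed (normFiber σ n c) := by
  have hop : IsOpen (valGE F (2 * n) : Set F) := isOpen_valGE _
  rw [← isOpen_compl_iff, isOpen_iff_mem_nhds]
  intro x hx
  have h1 : IsOpen ((fun z ↦ x - z) ⁻¹' (valGE F (2 * n) : Set F)) :=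
    hop.preimage (continuous_const.sub continuous_id)
  refine Filter.mem_of_superset (h1.mem_nhds (by simp [zero_mem])) fun z hz hz' ↦ hx ?_
  simpa using h.add_mem_normFiber hz' hz

lemma isCompact_normFiber (n : ℕ) (c : F) : IsCompact (normFiber σ n c) :=
  isCompact_valGE_zero.of_isClosed_subset (h.isClosed_normFiber n c)
    fun _ hx ↦ (mem_normFiber.1 hx).1

/-- Compactness of the ring of integers replaces a Hensel argument: the nested fibres are nonempty,
compact and closed, so they share a point. -/
lemma exists_norm_eq_of_forall_nonempty {c : F} (hc : ∀ n, (normFiber σ n c).Nonempty) :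
    ∃ x ∈ valGE F 0, x * σ x = c := by
  obtain ⟨x, hx⟩ := IsCompact.nonempty_iInter_of_sequence_nonempty_isCompact_isClosed
    (fun n ↦ normFiber σ n c) (fun n ↦ normFiber_anti n.le_succ c) hc
    (h.isCompact_normFiber 0 c) (fun n ↦ h.isClosed_normFiber n c)
  rw [Set.mem_iInter] at hx
  refine ⟨x, (mem_normFiber.1 (hx 0)).1, sub_eq_zero.1 (eq_zero_of_forall_mem_valGE fun n ↦ ?_)⟩
  exact valGE_anti (by omega) (mem_normFiber.1 (hx n)).2

lemma norm_unif_pow_mem (n : ℕ) : (ϖ * σ ϖ) ^ n ∈ valGE F (2 * n) :=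
  mem_valGE_of_val (h.val_norm_unif_pow n).ge

lemma one_add_twist_mem {a : F} (ha : a ∈ valGE F 0) (n : ℕ) :
    1 + a * twist σ ϖ n ∈ valGE F 0 := by
  refine add_mem one_mem_valGE ?_
  simpa using mul_mem_valGE ha (valGE_anti (by simp [h.val_twist]) (self_mem_valGE (twist σ ϖ n)))

lemma val_eq_zero_of_mem_normFiber {n : ℕ} (hn : 1 ≤ n) {c x : F} (hc0 : c ≠ 0)
    (hc : val F c = 0) (hx : x ∈ normFiber σ n c) :
    x ≠ 0 ∧ val F x = 0 := by
  obtain ⟨h1, h2⟩ := add_ne_zero_and_val (y := x * σ x - c) hc0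
    (by rw [hc]; exact valGE_anti (by omega) (mem_normFiber.1 hx).2)
  rw [add_sub_cancel] at h1 h2
  have hx0 := left_ne_zero_of_mul h1
  rw [val_mul hx0 (by simpa using hx0), h.val_conj] at h2
  exact ⟨hx0, by omega⟩

lemma exists_eq_norm_mul {n : ℕ} (hn : 1 ≤ n) {c x : F} (hcσ : σ c = c) (hc0 : c ≠ 0)
    (hc : val F c = 0) (hx : x ∈ normFiber σ n c) :
    ∃ t, σ t = t ∧ t ∈ valGE F 0 ∧ c = x * σ x * (1 + t * (ϖ * σ ϖ) ^ n) := by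
  obtain ⟨hx0, hxv⟩ := h.val_eq_zero_of_mem_normFiber hn hc0 hc hx
  have hσx : σ x ≠ 0 := by simpa using hx0
  have hN0 : x * σ x ≠ 0 := mul_ne_zero hx0 hσx
  have hp0 : (ϖ * σ ϖ) ^ n ≠ 0 := pow_ne_zero _ h.norm_unif_ne_zero
  refine ⟨(c - x * σ x) / (x * σ x * (ϖ * σ ϖ) ^ n), ?_, ?_, ?_⟩
  · exact fixed_div (by rw [map_sub, hcσ, h.norm_fixed])
      (by rw [map_mul, h.norm_fixed, h.norm_unif_pow_fixed])
  · have h1 := neg_mem (mem_normFiber.1 hx).2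
    rw [neg_sub] at h1
    have h2 : (x * σ x * (ϖ * σ ϖ) ^ n)⁻¹ ∈ valGE F (-(2 * n)) := by
      refine inv_mem_valGE ?_
      rw [val_mul hN0 hp0, h.val_norm_unif_pow, val_mul hx0 hσx, h.val_conj, hxv]
      omega
    rw [div_eq_mul_inv]
    exact valGE_anti (by omega) (mul_mem_valGE h1 h2)
  · have h0 := h.unif_ne_zero
    have h0' : σ ϖ ≠ 0 := by simpa using h0
    field_simp
    ring

variable {s : ℕ} (hs : val F (σ ϖ * ϖ⁻¹ - 1) = s)
include hs

/-- Away from the ramification break, the norm is surjective on the graded pieces of the unit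
filtration. -/
lemma normFiber_one_add_nonempty {n : ℕ} (hn : 1 ≤ n) (hns : n ≠ s) {t : F} (ht : σ t = t)
    (ht' : t ∈ valGE F 0) : (normFiber σ (n + 1) (1 + t * (ϖ * σ ϖ) ^ n)).Nonempty := by
  rcases lt_or_gt_of_ne hns with hlt | hlt
  -- Below the break: with y of valuation n, the norm term a²π^n matches tπ^n. The trace term has
  -- valuation at least n + s ≥ 2n + 1, hence 2n + 2, since it is fixed.
  · obtain ⟨a, ha, ha', haa⟩ := h.exists_sq_sub_mem ht ht'
    refine ⟨1 + a * twist σ ϖ n, mem_normFiber.2 ⟨h.one_add_twist_mem ha' n, ?_⟩⟩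
    have h1 := mul_mem_valGE ha' (h.trace_twist_mem hs n)
    have h2 := mul_mem_valGE haa (h.norm_unif_pow_mem n)
    have h1' := h.fixed_mem_succ (n := 2 * n + 1)
      (by rw [map_mul, ha, h.trace_fixed]) ⟨n, rfl⟩ (valGE_anti (by omega) h1)
    rw [norm_one_add_mul ha, h.norm_twist]
    convert add_mem (valGE_anti (show (2 * (n + 1 : ℕ) : ℤ) ≤ _ by push_cast; omega) h1')
      (valGE_anti (show (2 * (n + 1 : ℕ) : ℤ) ≤ _ by push_cast; omega) h2) using 1
    ring
  -- Above the break: y of valuation 2n - s has trace of valuation exactly 2n, so a Tr(y) = tπ^n is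
  -- solvable with integral a. The norm term has valuation at least 2(2n - s) ≥ 2n + 2.
  · have hpar : (2 * n - s) % 2 = s % 2 := by omega
    obtain ⟨hT0, hTv⟩ := h.trace_twist_val hs hpar
    have hp := h.norm_unif_pow_mem n
    set T := twist σ ϖ (2 * n - s) + σ (twist σ ϖ (2 * n - s)) with hT
    set a := t * (ϖ * σ ϖ) ^ n / T with ha_def
    have ha : σ a = a := fixed_div (by rw [map_mul, ht, h.norm_unif_pow_fixed]) (h.trace_fixed _)
    have ha' : a ∈ valGE F 0 := by
      rw [ha_def, div_eq_mul_inv]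
      have := mul_mem_valGE (mul_mem_valGE ht' hp) (inv_mem_valGE (x := T) le_rfl)
      exact valGE_anti (by omega) this
    refine ⟨1 + a * twist σ ϖ (2 * n - s), mem_normFiber.2 ⟨h.one_add_twist_mem ha' _, ?_⟩⟩
    rw [norm_one_add_mul ha, h.norm_twist, ← hT]
    have h1 : a * T = t * (ϖ * σ ϖ) ^ n := div_mul_cancel₀ _ hT0
    rw [h1, add_sub_cancel_left]
    have := mul_mem_valGE (mul_mem_valGE ha' ha') (h.norm_unif_pow_mem (2 * n - s))
    exact valGE_anti (by push_cast; omega) this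

lemma normFiber_nonempty_succ {n : ℕ} (hns : n ≠ s) {c : F} (hcσ : σ c = c) (hc0 : c ≠ 0)
    (hc : val F c = 0) (hne : (normFiber σ n c).Nonempty) : (normFiber σ (n + 1) c).Nonempty := by
  have hcm : c ∈ valGE F 0 := mem_valGE_of_val hc.ge
  rcases Nat.eq_zero_or_pos n with rfl | hn
  · obtain ⟨a, ha, ha', haa⟩ := h.exists_sq_sub_mem hcσ hcm
    exact ⟨a, mem_normFiber.2 ⟨ha', by rw [ha]; simpa using haa⟩⟩
  · obtain ⟨x, hx⟩ := hne
    obtain ⟨t, ht, ht', rfl⟩ := h.exists_eq_norm_mul hn hcσ hc0 hc hx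
    obtain ⟨v, hv⟩ := h.normFiber_one_add_nonempty hs hn hns ht ht'
    have hx0 := (mem_normFiber.1 hx).1
    refine ⟨x * v, h.mul_mem_normFiber (by simpa using mul_mem_valGE hx0 (h.conj_mem hx0)) ?_ hv⟩
    exact mem_normFiber.2 ⟨hx0, by rw [sub_self]; exact zero_mem _⟩

lemma normFiber_nonempty_of_le {n : ℕ} (hn : n ≤ s) {c : F} (hcσ : σ c = c) (hc0 : c ≠ 0)
    (hc : val F c = 0) : (normFiber σ n c).Nonempty := by
  induction n with
  | zero =>
    refine ⟨0, mem_normFiber.2 ⟨zero_mem _, ?_⟩⟩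
    rw [zero_mul, zero_sub]
    exact neg_mem (mem_valGE_of_val (by simp [hc]))
  | succ n ih => exact h.normFiber_nonempty_succ hs (by omega) hcσ hc0 hc (ih (by omega))

/-- A unit which is a norm to a precision beyond the ramification break is a norm. -/
lemma exists_norm_eq {c : F} (hcσ : σ c = c) (hc0 : c ≠ 0) (hc : val F c = 0)
    (hne : (normFiber σ (s + 1) c).Nonempty) : ∃ x ∈ valGE F 0, x * σ x = c := by
  refine h.exists_norm_eq_of_forall_nonempty fun n ↦ ?_
  rcases le_total n (s + 1) with hn | hn
  · exact hne.mono (normFiber_anti hn c)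
  · induction n, hn using Nat.le_induction with
    | base => exact hne
    | succ n hn ih => exact h.normFiber_nonempty_succ hs (by omega) hcσ hc0 hc ih

lemma normFiber_eq_empty {n : ℕ} (hn : s < n) {c : F} (hcσ : σ c = c) (hc0 : c ≠ 0)
    (hc : val F c = 0) (hcn : ¬ ∃ x ∈ valGE F 0, x * σ x = c) : normFiber σ n c = ∅ := by
  rw [← Set.not_nonempty_iff_eq_empty]
  exact fun hne ↦ hcn (h.exists_norm_eq hs hcσ hc0 hc (hne.mono (normFiber_anti hn c)))

/-- At the ramification break, the norm has an image of index two. -/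
lemma normFiber_break_add {t u : F} (ht : σ t = t) (ht' : t ∈ valGE F 0) (hu : σ u = u)
    (hu' : u ∈ valGE F 0) (htn : ¬ (normFiber σ (s + 1) (1 + t * (ϖ * σ ϖ) ^ s)).Nonempty)
    (hun : ¬ (normFiber σ (s + 1) (1 + u * (ϖ * σ ϖ) ^ s)).Nonempty) :
    (normFiber σ (s + 1) (1 + (t + u) * (ϖ * σ ϖ) ^ s)).Nonempty := by
  have := h.charTwo
  obtain ⟨hT0, hTv⟩ := h.trace_twist_val hs (n := s) rfl
  have hp := h.norm_unif_pow_mem s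
  have hp0 : (ϖ * σ ϖ) ^ s ≠ 0 := pow_ne_zero _ h.norm_unif_ne_zero
  set T := twist σ ϖ s + σ (twist σ ϖ s) with hT
  set β := T / (ϖ * σ ϖ) ^ s with hβ_def
  have hβ : σ β = β := fixed_div (h.trace_fixed _) (h.norm_unif_pow_fixed s)
  have hβ0 : β ≠ 0 := div_ne_zero hT0 hp0
  have hβv : val F β = 0 := by
    rw [hβ_def, val_div hT0 hp0, hTv, h.val_norm_unif_pow]
    omega
  have hβ' : β ∈ valGE F 0 := mem_valGE_of_val hβv.ge
  have hb0 : red β ≠ 0 := by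
    rw [Ne, red_eq_zero_iff hβ', mem_valGE hβ0, hβv]
    omega
  -- Reduction of the coefficient of π^s in N(1 + ay), where β = Tr(y)/π^s is a unit. It is additive
  -- in characteristic 2 with kernel {0, β}, so its range has index 2 and contains the sum of any
  -- two elements outside it.
  let φ : 𝓀[F] →+ 𝓀[F] :=
    { toFun := fun a ↦ a * a + a * red β
      map_zero' := by simp
      map_add' := fun a b ↦ by
        have : (2 : 𝓀[F]) = 0 := CharTwo.two_eq_zero
        linear_combination a * b * this }
  have hφ : ∀ a, φ a = a * a + a * red β := fun _ ↦ rfl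
  have key : ∀ w, σ w = w → w ∈ valGE F 0 → red w ∈ φ.range →
      (normFiber σ (s + 1) (1 + w * (ϖ * σ ϖ) ^ s)).Nonempty := by
    rintro w hw hw' ⟨r, hr⟩
    obtain ⟨a, ha, ha', rfl⟩ := h.exists_fixed_red_eq r
    refine ⟨1 + a * twist σ ϖ s, mem_normFiber.2 ⟨h.one_add_twist_mem ha' s, ?_⟩⟩
    rw [norm_one_add_mul ha, h.norm_twist, ← hT]
    have haa : a * a ∈ valGE F 0 := by simpa using mul_mem_valGE ha' ha'
    have hab : a * β ∈ valGE F 0 := by simpa using mul_mem_valGE ha' hβ'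
    have hsum := add_mem haa hab
    have h1 : a * a + a * β - w ∈ valGE F 2 := by
      refine h.fixed_sub_mem_two (by simp only [map_add, map_mul, ha, hβ]) hw hsum hw' ?_
      rw [red_add haa hab, red_mul ha' ha', red_mul ha' hβ', ← hφ, hr]
    have h2 := mul_mem_valGE h1 hp
    have hTβ : T = β * (ϖ * σ ϖ) ^ s := (div_mul_cancel₀ _ hp0).symm
    rw [hTβ]
    convert valGE_anti (show (2 * (s + 1 : ℕ) : ℤ) ≤ _ by push_cast; omega) h2 using 1
    ring
  have hindex : φ.range.index = 2 := by
    have hker : Nat.card φ.ker = 2 := by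
      have : (φ.ker : Set 𝓀[F]) = {0, red β} := by
        ext a
        simp only [SetLike.mem_coe, AddMonoidHom.mem_ker, hφ, Set.mem_insert_iff,
          Set.mem_singleton_iff, ← mul_add, mul_eq_zero]
        rw [CharTwo.add_eq_zero]
      rw [← SetLike.coe_sort_coe, this, Nat.card_coe_set_eq, Set.ncard_pair hb0.symm]
    have h1 := φ.range.card_mul_index
    have h2 := φ.ker.card_mul_index
    rw [AddSubgroup.index_ker, hker, ← h1, mul_comm] at h2
    exact (Nat.eq_of_mul_eq_mul_left Nat.card_pos h2).symm
  refine key _ (by rw [map_add, ht, hu]) (add_mem ht' hu') ?_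
  rw [red_add ht' hu']
  rw [AddSubgroup.add_mem_iff_of_index_two hindex]
  exact iff_of_false (fun hh ↦ htn (key t ht ht' hh)) (fun hh ↦ hun (key u hu hu' hh))

/-- The product of two units which are not norms is a norm. -/
lemma exists_norm_eq_mul {c d : F} (hcσ : σ c = c) (hc0 : c ≠ 0) (hc : val F c = 0)
    (hdσ : σ d = d) (hd0 : d ≠ 0) (hd : val F d = 0)
    (hcn : ¬ ∃ x ∈ valGE F 0, x * σ x = c) (hdn : ¬ ∃ x ∈ valGE F 0, x * σ x = d) :
    ∃ x ∈ valGE F 0, x * σ x = c * d := by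
  have hs1 := h.one_le_break hs
  obtain ⟨x, hx⟩ := h.normFiber_nonempty_of_le hs le_rfl hcσ hc0 hc
  obtain ⟨y, hy⟩ := h.normFiber_nonempty_of_le hs le_rfl hdσ hd0 hd
  obtain ⟨t, ht, ht', hct⟩ := h.exists_eq_norm_mul hs1 hcσ hc0 hc hx
  obtain ⟨u, hu, hu', hdu⟩ := h.exists_eq_norm_mul hs1 hdσ hd0 hd hy
  have hx0 := (mem_normFiber.1 hx).1
  have hy0 := (mem_normFiber.1 hy).1
  have hN : ∀ {z : F}, z ∈ valGE F 0 → z * σ z ∈ valGE F 0 := fun hz ↦ by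
    simpa using mul_mem_valGE hz (h.conj_mem hz)
  have hself : ∀ {z : F}, z ∈ valGE F 0 → z ∈ normFiber σ (s + 1) (z * σ z) := fun hz ↦
    mem_normFiber.2 ⟨hz, by rw [sub_self]; exact zero_mem _⟩
  obtain ⟨v, hv⟩ := h.normFiber_break_add hs ht ht' hu hu'
    (fun ⟨v, hv⟩ ↦ hcn (h.exists_norm_eq hs hcσ hc0 hc
      ⟨x * v, hct ▸ h.mul_mem_normFiber (hN hx0) (hself hx0) hv⟩))
    (fun ⟨v, hv⟩ ↦ hdn (h.exists_norm_eq hs hdσ hd0 hd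
      ⟨y * v, hdu ▸ h.mul_mem_normFiber (hN hy0) (hself hy0) hv⟩))
  refine h.exists_norm_eq hs (by rw [map_mul, hcσ, hdσ]) (mul_ne_zero hc0 hd0)
    (by rw [val_mul hc0 hd0, hc, hd, add_zero]) ⟨x * y * v, ?_⟩
  have hxy : x * y ∈ valGE F 0 := by simpa using mul_mem_valGE hx0 hy0
  have hmem := h.mul_mem_normFiber (hN hxy) (hself hxy) hv
  -- The product of 1 + tπ^s and 1 + uπ^s differs from 1 + (t+u)π^s by tuπ^(2s), of valuation at
  -- least 4s ≥ 2(s + 1) because s ≥ 1.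
  rw [normFiber_congr] at hmem
  · exact hmem
  have hp := h.norm_unif_pow_mem s
  have h1 := mul_mem_valGE (hN hxy) (mul_mem_valGE (mul_mem_valGE ht' hu') (mul_mem_valGE hp hp))
  rw [← neg_mem_iff]
  convert valGE_anti (show (2 * (s + 1 : ℕ) : ℤ) ≤ _ by push_cast; omega) h1 using 1
  rw [hct, hdu, map_mul]
  ring

end

end IsRamifiedInvolution

/-! ### Haar measure under multiplication by units -/

section Scaling

lemma preimage_mul_valGE {K : Type*} [Field K] [ValuativeRel K] [TopologicalSpace K]
    [IsNonarchimedeanLocalField K] {v : K} (hv0 : v ≠ 0) (hv : val K v = 0) (n : ℤ) :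
    (v * ·) ⁻¹' (valGE K n : Set K) = valGE K n := by
  ext x
  simp only [Set.mem_preimage, SetLike.mem_coe]
  rw [mul_mem_valGE_iff hv0, hv, sub_zero]

variable {K : Type*} [Field K] [ValuativeRel K] [TopologicalSpace K]
  [IsNonarchimedeanLocalField K] [MeasurableSpace K] [BorelSpace K]

/-- Multiplication by a unit of the ring of integers preserves Haar measure. -/
lemma measure_preimage_mul_unit (μ : Measure K) [μ.IsAddHaarMeasure]
    (hμ : μ (𝒪[K] : Set K) = 1) {v : K} (hv0 : v ≠ 0) (hv : val K v = 0) {A : Set K}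
    (hA : IsCompact A) : μ ((v * ·) ⁻¹' A) = μ A := by
  let e : K ≃+ K := { Equiv.mulLeft₀ v hv0 with map_add' := mul_add v }
  have he : Continuous e := continuous_const_mul v
  have he' : Continuous e.symm := continuous_const_mul v⁻¹
  have hmap : (μ.map e).IsAddHaarMeasure := e.isAddHaarMeasure_map μ he he'
  let E : K ≃ₜ K := ⟨e.toEquiv, he, he'⟩
  have happ : ∀ A : Set K, μ.map e A = μ ((v * ·) ⁻¹' A) := fun A ↦
    E.toMeasurableEquiv.map_apply A
  have hscale : ∀ {A : Set K}, IsCompact (closure A) →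
      μ.map e A = Measure.addHaarScalarFactor (μ.map e) μ • μ A := fun hA ↦
    Measure.measure_isAddInvariant_eq_smul_of_isCompact_closure (μ.map e) μ hA
  -- The scalar between the two Haar measures is read off on the ring of integers, which a unit
  -- preserves.
  have hone := hscale (A := valGE K 0) (isCompact_valGE_zero.closure)
  rw [happ, preimage_mul_valGE hv0 hv, ← coe_integer_eq, hμ, ENNReal.smul_def, smul_eq_mul,
    mul_one, eq_comm, ENNReal.coe_eq_one] at hone
  rw [← happ, hscale hA.closure, hone, one_smul]

end Scaling

/-! ### Measures of the norm fibres -/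

namespace IsRamifiedInvolution

variable {F : Type*} [Field F] [ValuativeRel F] [TopologicalSpace F]
  [IsNonarchimedeanLocalField F] {σ : F ≃+* F} {ϖ : F}

lemma normFiber_zero {c : F} (hc : c ∈ valGE F 0) (hσ : ∀ x ∈ valGE F 0, σ x ∈ valGE F 0) :
    normFiber σ 0 c = valGE F 0 := by
  ext x
  rw [mem_normFiber]
  refine ⟨fun hx ↦ hx.1, fun hx ↦ ⟨hx, ?_⟩⟩
  have := sub_mem (mul_mem_valGE hx (hσ x hx)) (by simpa using hc)
  simpa using this

section

variable (h : IsRamifiedInvolution σ ϖ)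
include h

lemma trace_mem {x : F} (hx : x ∈ valGE F 0) : x + σ x ∈ valGE F 2 := by
  refine h.fixed_mem_succ (h.trace_fixed x) odd_one ?_
  obtain ⟨a, b, ha, hb, ha', hb', rfl⟩ := h.decomp_mem hx
  have hu := self_mem_valGE ϖ
  rw [h.unif] at hu
  have h1 := mul_mem_valGE h.two_mem ha'
  have h2 := mul_mem_valGE hb' (add_mem hu (h.conj_mem hu))
  rw [add_zero] at h1
  rw [zero_add] at h2
  convert add_mem h1 h2 using 1
  rw [map_add, map_mul, ha, hb]
  ring

lemma unit_one_add {n : ℕ} (hn : 1 ≤ n) {t : F} (ht : t ∈ valGE F 0) :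
    1 + t * (ϖ * σ ϖ) ^ n ≠ 0 ∧ val F (1 + t * (ϖ * σ ϖ) ^ n) = 0 := by
  have := add_ne_zero_and_val (x := (1 : F)) (y := t * (ϖ * σ ϖ) ^ n) one_ne_zero (by
    rw [val_one]
    exact valGE_anti (by omega) (mul_mem_valGE ht (h.norm_unif_pow_mem n)))
  rwa [val_one] at this

lemma one_add_fixed {t : F} (ht : σ t = t) (n : ℕ) :
    σ (1 + t * (ϖ * σ ϖ) ^ n) = 1 + t * (ϖ * σ ϖ) ^ n := by
  rw [map_add, map_one, map_mul, ht, h.norm_unif_pow_fixed]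

lemma mul_mem_normFiber_iff {n : ℕ} {c v x : F} (hv0 : v ≠ 0) (hv : val F v = 0) :
    v * x ∈ normFiber σ n (v * σ v * c) ↔ x ∈ normFiber σ n c := by
  have hσv : σ v ≠ 0 := by simpa using hv0
  rw [mem_normFiber, mem_normFiber, mul_mem_valGE_iff hv0, hv, sub_zero]
  have : v * x * σ (v * x) - v * σ v * c = v * σ v * (x * σ x - c) := by
    rw [map_mul]; ring
  rw [this, mul_mem_valGE_iff (mul_ne_zero hv0 hσv), val_mul hv0 hσv, h.val_conj, hv, add_zero,
    sub_zero]

lemma exists_norm_of_mul {c d : F} (hc0 : c ≠ 0) (hd : val F d = 0)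
    (hc : ∃ x ∈ valGE F 0, x * σ x = c) (hcd : ∃ x ∈ valGE F 0, x * σ x = c * d) :
    ∃ x ∈ valGE F 0, x * σ x = d := by
  obtain ⟨x, hx, rfl⟩ := hc
  obtain ⟨y, hy, hxy⟩ := hcd
  have hx0 := left_ne_zero_of_mul hc0
  have hσx0 := right_ne_zero_of_mul hc0
  have key : y / x * σ (y / x) = d := by
    rw [map_div₀, div_mul_div_comm, hxy, mul_div_cancel_left₀ _ hc0]
  refine ⟨y / x, ?_, key⟩
  by_cases hyx : y / x = 0
  · rw [hyx]; exact zero_mem _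
  rw [← key, val_mul hyx (by simpa using hyx), h.val_conj] at hd
  exact mem_valGE_of_val (by omega)

variable [MeasurableSpace F] [BorelSpace F] (μ : Measure F)

lemma measurableSet_normFiber (n : ℕ) (c : F) : MeasurableSet (normFiber σ n c) :=
  (h.isOpen_normFiber n c).measurableSet

/-- The norm fibres over `c` are the disjoint union of the norm fibres of the next level over
representatives of the classes congruent to `c`. -/
lemma measure_normFiber_eq_sum [Fintype 𝓀[F]] {ρ : 𝓀[F] → F}
    (hρ : ∀ t, σ (ρ t) = ρ t ∧ ρ t ∈ valGE F 0 ∧ red (ρ t) = t) {c e : F} (hc : σ c = c)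
    (he : σ e = e) (he0 : e ≠ 0) (hev : val F e = 0) (n : ℕ) :
    μ (normFiber σ n c) = ∑ t, μ (normFiber σ (n + 1) (c + e * ρ t * (ϖ * σ ϖ) ^ n)) := by
  have hp := h.norm_unif_pow_mem n
  have hp0 : (ϖ * σ ϖ) ^ n ≠ 0 := pow_ne_zero _ h.norm_unif_ne_zero
  have hpv := h.val_norm_unif_pow n
  have hep0 : e * (ϖ * σ ϖ) ^ n ≠ 0 := mul_ne_zero he0 hp0
  have hepv : val F (e * (ϖ * σ ϖ) ^ n) = 2 * n := by rw [val_mul he0 hp0, hev, hpv, zero_add]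
  have hem : e ∈ valGE F 0 := mem_valGE_of_val hev.ge
  have hU : normFiber σ n c = ⋃ t, normFiber σ (n + 1) (c + e * ρ t * (ϖ * σ ϖ) ^ n) := by
    ext x
    simp only [Set.mem_iUnion, mem_normFiber]
    constructor
    · rintro ⟨hx, hxc⟩
      set w := (x * σ x - c) / (e * (ϖ * σ ϖ) ^ n) with hw
      have hwσ : σ w = w := fixed_div (by rw [map_sub, h.norm_fixed, hc])
        (by rw [map_mul, he, h.norm_unif_pow_fixed])
      have hxw : x * σ x - c = e * (ϖ * σ ϖ) ^ n * w := (mul_div_cancel₀ _ hep0).symm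
      have hwm : w ∈ valGE F 0 := by
        rw [hxw, mul_mem_valGE_iff hep0, hepv, sub_self] at hxc
        exact hxc
      refine ⟨red w, hx, ?_⟩
      obtain ⟨h1, h2, h3⟩ := hρ (red w)
      have h4 := h.fixed_sub_mem_two hwσ h1 hwm h2 h3.symm
      have : x * σ x - (c + e * ρ (red w) * (ϖ * σ ϖ) ^ n)
          = e * (ϖ * σ ϖ) ^ n * (w - ρ (red w)) := by linear_combination hxw
      rw [this, mul_mem_valGE_iff hep0, hepv]
      exact valGE_anti (by push_cast; omega) h4
    · rintro ⟨t, hx, hxt⟩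
      refine ⟨hx, ?_⟩
      have h1 := mul_mem_valGE (mul_mem_valGE hem (hρ t).2.1) hp
      convert add_mem (valGE_anti (show (2 * n : ℤ) ≤ _ by push_cast; omega) hxt)
        (valGE_anti (show (2 * n : ℤ) ≤ _ by omega) h1) using 1
      ring
  rw [hU, measure_iUnion _ (fun t ↦ h.measurableSet_normFiber _ _), tsum_fintype]
  intro t u htu
  refine Set.disjoint_left.2 fun x hx hx' ↦ htu ?_
  have h1 := sub_mem (mem_normFiber.1 hx').2 (mem_normFiber.1 hx).2
  have h2 : x * σ x - (c + e * ρ u * (ϖ * σ ϖ) ^ n) - (x * σ x - (c + e * ρ t * (ϖ * σ ϖ) ^ n))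
      = e * (ϖ * σ ϖ) ^ n * (ρ t - ρ u) := by ring
  rw [h2, mul_mem_valGE_iff hep0, hepv] at h1
  rw [← (hρ t).2.2, ← (hρ u).2.2, red_eq_red_iff (hρ t).2.1 (hρ u).2.1]
  exact valGE_anti (by push_cast; omega) h1

variable [μ.IsAddHaarMeasure] (hμ : μ (𝒪[F] : Set F) = 1)

/-- Traces of integers have valuation at least 2, so translating by a fixed `a` changes the norm by
a² at this precision. As every residue class is a square, translations permute the subfibres
transitively. -/
lemma measure_normFiber_zero_eq {c : F} (hc : σ c = c) :
    μ (normFiber σ 0 c) = Nat.card 𝓀[F] * μ (normFiber σ 1 c) := by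
  have : Fintype 𝓀[F] := Fintype.ofFinite _
  choose ρ hρ using h.exists_fixed_red_eq
  have hsum := h.measure_normFiber_eq_sum μ hρ hc (map_one σ) one_ne_zero val_one 0
  rw [hsum, Finset.sum_congr rfl (g := fun _ ↦ μ (normFiber σ 1 c)), Finset.sum_const,
    nsmul_eq_mul, Nat.card_eq_fintype_card, Finset.card_univ]
  intro t _
  obtain ⟨a, ha, ha', haa⟩ := h.exists_sq_sub_mem (hρ t).1 (hρ t).2.1
  rw [one_mul, pow_zero, mul_one, ← measure_preimage_add_right μ a]
  congr 1
  ext x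
  rw [Set.mem_preimage, mem_normFiber, mem_normFiber, add_mem_cancel_right ha']
  refine and_congr_right fun hx ↦ ?_
  have h1 := add_mem (mul_mem_valGE ha' (h.trace_mem hx)) (by simpa using haa)
  rw [zero_add] at h1
  have h2 : (x + a) * σ (x + a) - (c + ρ t)
      = (x * σ x - c) + (a * (x + σ x) + (a * a - ρ t)) := by
    rw [map_add, ha]; ring
  rw [h2]
  exact add_mem_cancel_right (by simpa using h1)

include hμ

lemma measure_normFiber_norm_mul {n : ℕ} {c v : F} (hv0 : v ≠ 0) (hv : val F v = 0) :
    μ (normFiber σ n (v * σ v * c)) = μ (normFiber σ n c) := by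
  rw [← measure_preimage_mul_unit μ hμ hv0 hv (h.isCompact_normFiber _ _)]
  congr 1
  ext x
  exact h.mul_mem_normFiber_iff hv0 hv

lemma measure_normFiber_mul_of_nonempty {n : ℕ} (hn : 1 ≤ n) {c d : F} (hc : c ∈ valGE F 0)
    (hd0 : d ≠ 0) (hd : val F d = 0) (hne : (normFiber σ n d).Nonempty) :
    μ (normFiber σ n (c * d)) = μ (normFiber σ n c) := by
  obtain ⟨v, hv⟩ := hne
  obtain ⟨hv0, hvv⟩ := h.val_eq_zero_of_mem_normFiber hn hd0 hd hv
  rw [← h.measure_normFiber_norm_mul μ hμ (c := c) hv0 hvv]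
  refine congrArg μ (normFiber_congr ?_)
  have := mul_mem_valGE hc (neg_mem (mem_normFiber.1 hv).2)
  rw [zero_add] at this
  convert this using 1
  ring

lemma measure_normFiber_of_norm {n : ℕ} {c : F} (hc0 : c ≠ 0)
    (hc : val F c = 0) (hcn : ∃ x ∈ valGE F 0, x * σ x = c) :
    μ (normFiber σ n c) = μ (normFiber σ n 1) := by
  obtain ⟨x, hx, rfl⟩ := hcn
  have hx0 := left_ne_zero_of_mul hc0
  rw [val_mul hx0 (by simpa using hx0), h.val_conj] at hc
  rw [← h.measure_normFiber_norm_mul μ hμ (c := 1) hx0 (by omega), mul_one]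

variable {s : ℕ} (hs : val F (σ ϖ * ϖ⁻¹ - 1) = s)
include hs

/-- For n ≥ 1 the subfibres lie over c(1 + tπ^n), and away from the break each factor 1 + tπ^n is a
norm to precision n + 1, so all have the measure of the one over `c`. -/
lemma measure_normFiber_eq_mul_succ {n : ℕ} (hns : n ≠ s) {c : F} (hcσ : σ c = c) (hc0 : c ≠ 0)
    (hc : val F c = 0) :
    μ (normFiber σ n c) = Nat.card 𝓀[F] * μ (normFiber σ (n + 1) c) := by
  have hcm : c ∈ valGE F 0 := mem_valGE_of_val hc.ge
  rcases Nat.eq_zero_or_pos n with rfl | hn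
  · exact h.measure_normFiber_zero_eq μ hcσ
  have : Fintype 𝓀[F] := Fintype.ofFinite _
  choose ρ hρ using h.exists_fixed_red_eq
  have hsum := h.measure_normFiber_eq_sum μ hρ hcσ hcσ hc0 hc n
  rw [hsum, Finset.sum_congr rfl (g := fun _ ↦ μ (normFiber σ (n + 1) c)), Finset.sum_const,
    nsmul_eq_mul, Nat.card_eq_fintype_card, Finset.card_univ]
  intro t _
  obtain ⟨h1, h2⟩ := h.unit_one_add hn (hρ t).2.1
  have := h.measure_normFiber_mul_of_nonempty μ hμ (n := n + 1) (by omega) hcm h1 h2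
    (h.normFiber_one_add_nonempty hs hn hns (hρ t).1 (hρ t).2.1)
  rw [← this]
  congr 2
  ring

/-- Multiplication by a non-norm w = 1 + t₀π^s swaps norms and non-norms among the classes `u t`,
and amounts to the shift of `t` by `red t₀`. In each pair `t`, `t + red t₀` exactly one subfibre is
nonempty; summing over all `t` counts the total twice. -/
lemma two_mul_measure_normFiber_break {c d : F} (hcσ : σ c = c) (hc0 : c ≠ 0)
    (hc : val F c = 0) (hcn : ∃ x ∈ valGE F 0, x * σ x = c) (hdσ : σ d = d) (hd0 : d ≠ 0)
    (hd : val F d = 0) (hdn : ¬ ∃ x ∈ valGE F 0, x * σ x = d) :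
    2 * μ (normFiber σ s c) = Nat.card 𝓀[F] * μ (normFiber σ (s + 1) c) := by
  have hcm : c ∈ valGE F 0 := mem_valGE_of_val hc.ge
  have hs1 := h.one_le_break hs
  have : Fintype 𝓀[F] := Fintype.ofFinite _
  choose ρ hρ using h.exists_fixed_red_eq
  have hp := h.norm_unif_pow_mem s
  obtain ⟨x, hx⟩ := h.normFiber_nonempty_of_le hs le_rfl hdσ hd0 hd
  obtain ⟨t₀, ht₀, ht₀', hdt⟩ := h.exists_eq_norm_mul hs1 hdσ hd0 hd hx
  obtain ⟨hw0, hwv⟩ := h.unit_one_add hs1 ht₀'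
  have hwσ := h.one_add_fixed ht₀ s
  set w := 1 + t₀ * (ϖ * σ ϖ) ^ s with hw
  have hwn : ¬ ∃ x ∈ valGE F 0, x * σ x = w := by
    rintro ⟨y, hy, hyw⟩
    refine hdn ⟨x * y, by simpa using mul_mem_valGE (mem_normFiber.1 hx).1 hy, ?_⟩
    rw [hdt, ← hyw, map_mul]
    ring
  set u : 𝓀[F] → F := fun t ↦ c * (1 + ρ t * (ϖ * σ ϖ) ^ s) with hu
  have huσ : ∀ t, σ (u t) = u t := fun t ↦ by
    rw [hu]; simp only; rw [map_mul, hcσ, h.one_add_fixed (hρ t).1]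
  have hu0 : ∀ t, u t ≠ 0 := fun t ↦ mul_ne_zero hc0 (h.unit_one_add hs1 (hρ t).2.1).1
  have huv : ∀ t, val F (u t) = 0 := fun t ↦ by
    rw [hu]; simp only
    rw [val_mul hc0 (h.unit_one_add hs1 (hρ t).2.1).1, hc, (h.unit_one_add hs1 (hρ t).2.1).2,
      add_zero]
  have hshift : ∀ t, u (t + red t₀) - u t * w ∈ valGE F (2 * (s + 1 : ℕ)) := fun t ↦ by
    have h1 : ρ (t + red t₀) - (ρ t + t₀) ∈ valGE F 2 :=
      h.fixed_sub_mem_two (hρ _).1 (by rw [map_add, (hρ t).1, ht₀]) (hρ _).2.1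
        (add_mem (hρ t).2.1 ht₀') (by rw [(hρ _).2.2, red_add (hρ t).2.1 ht₀', (hρ t).2.2])
    have h2 := mul_mem_valGE (mul_mem_valGE (hρ t).2.1 ht₀') hp
    have h3 := mul_mem_valGE hcm (mul_mem_valGE
      (sub_mem h1 (valGE_anti (show (2 : ℤ) ≤ _ by omega) h2)) hp)
    convert valGE_anti (show (2 * (s + 1 : ℕ) : ℤ) ≤ _ by push_cast; omega) h3 using 1
    rw [hu, hw]
    ring
  have hclass : ∀ t, (∃ x ∈ valGE F 0, x * σ x = u (t + red t₀)) ↔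
      ∃ x ∈ valGE F 0, x * σ x = u t * w := by
    intro t
    have hself : ∀ {z : F}, z ∈ valGE F 0 → z ∈ normFiber σ (s + 1) (z * σ z) := fun hz ↦
      mem_normFiber.2 ⟨hz, by rw [sub_self]; exact zero_mem _⟩
    have hcongr := normFiber_congr (σ := σ) (hshift t)
    constructor
    · rintro ⟨y, hy, hyu⟩
      exact h.exists_norm_eq hs (by rw [map_mul, huσ, hwσ]) (mul_ne_zero (hu0 t) hw0)
        (by rw [val_mul (hu0 t) hw0, huv, hwv, add_zero]) ⟨y, hcongr ▸ hyu ▸ hself hy⟩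
    · rintro ⟨y, hy, hyu⟩
      exact h.exists_norm_eq hs (huσ _) (hu0 _) (huv _) ⟨y, hcongr.symm ▸ hyu ▸ hself hy⟩
  have hnorm : ∀ t, (∃ x ∈ valGE F 0, x * σ x = u t) →
      μ (normFiber σ (s + 1) (u t)) = μ (normFiber σ (s + 1) c) := fun t ht ↦ by
    rw [h.measure_normFiber_of_norm μ hμ (hu0 t) (huv t) ht,
      h.measure_normFiber_of_norm μ hμ hc0 hc hcn]
  have hnot : ∀ t, (¬ ∃ x ∈ valGE F 0, x * σ x = u t) →
      μ (normFiber σ (s + 1) (u t)) = 0 := fun t ht ↦ by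
    rw [h.normFiber_eq_empty hs (Nat.lt_succ_self s) (huσ t) (hu0 t) (huv t) ht, measure_empty]
  have hpair : ∀ t, μ (normFiber σ (s + 1) (u t)) + μ (normFiber σ (s + 1) (u (t + red t₀)))
      = μ (normFiber σ (s + 1) c) := by
    intro t
    by_cases ht : ∃ x ∈ valGE F 0, x * σ x = u t
    · rw [hnorm t ht, hnot _ fun ht' ↦ hwn
        (h.exists_norm_of_mul (hu0 t) hwv ht ((hclass t).1 ht')), add_zero]
    · rw [hnot t ht, zero_add, hnorm _ ((hclass t).2
        (h.exists_norm_eq_mul hs (huσ t) (hu0 t) (huv t) hwσ hw0 hwv ht hwn))]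
  have hsum : μ (normFiber σ s c) = ∑ t, μ (normFiber σ (s + 1) (u t)) := by
    rw [h.measure_normFiber_eq_sum μ hρ hcσ hcσ hc0 hc s]
    refine Finset.sum_congr rfl fun t _ ↦ ?_
    rw [hu]
    congr 2
    ring
  have hsum' : μ (normFiber σ s c) = ∑ t, μ (normFiber σ (s + 1) (u (t + red t₀))) := by
    rw [hsum]
    exact (Equiv.sum_comp (Equiv.addRight (red t₀)) fun t ↦ μ (normFiber σ (s + 1) (u t))).symm
  calc 2 * μ (normFiber σ s c) = μ (normFiber σ s c) + μ (normFiber σ s c) := two_mul _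
    _ = ∑ t, (μ (normFiber σ (s + 1) (u t)) + μ (normFiber σ (s + 1) (u (t + red t₀)))) := by
      rw [Finset.sum_add_distrib, ← hsum, ← hsum']
    _ = _ := by
      rw [Finset.sum_congr rfl fun t _ ↦ hpair t, Finset.sum_const, nsmul_eq_mul,
        Nat.card_eq_fintype_card, Finset.card_univ]

lemma measure_normFiber_of_le {n : ℕ} (hn : n ≤ s) {c : F} (hcσ : σ c = c) (hc0 : c ≠ 0)
    (hc : val F c = 0) : (Nat.card 𝓀[F] : ENNReal) ^ n * μ (normFiber σ n c) = 1 := by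
  induction n with
  | zero =>
    rw [pow_zero, one_mul, normFiber_zero (mem_valGE_of_val hc.ge) fun x hx ↦ h.conj_mem hx,
      ← coe_integer_eq, hμ]
  | succ n ih =>
    rw [pow_succ, mul_assoc, ← h.measure_normFiber_eq_mul_succ μ hμ hs (by omega) hcσ hc0 hc]
    exact ih (by omega)

lemma measure_normFiber_of_lt {n : ℕ} (hn : s < n) {c d : F} (hcσ : σ c = c) (hc0 : c ≠ 0)
    (hc : val F c = 0) (hcn : ∃ x ∈ valGE F 0, x * σ x = c) (hdσ : σ d = d) (hd0 : d ≠ 0)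
    (hd : val F d = 0) (hdn : ¬ ∃ x ∈ valGE F 0, x * σ x = d) :
    (Nat.card 𝓀[F] : ENNReal) ^ n * μ (normFiber σ n c) = 2 := by
  induction n, hn using Nat.le_induction with
  | base =>
    rw [pow_succ, mul_assoc,
      ← h.two_mul_measure_normFiber_break μ hμ hs hcσ hc0 hc hcn hdσ hd0 hd hdn, mul_left_comm,
      h.measure_normFiber_of_le μ hμ hs le_rfl hcσ hc0 hc, mul_one]
  | succ n hn ih =>
    rw [pow_succ, mul_assoc, ← h.measure_normFiber_eq_mul_succ μ hμ hs (by omega) hcσ hc0 hc, ih]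

end

end IsRamifiedInvolution

/-! ### Passage from the extension to the involution, and the norm character -/

section Extension

variable {E F : Type*}
    [Field E] [ValuativeRel E] [TopologicalSpace E] [IsNonarchimedeanLocalField E]
    [Field F] [ValuativeRel F] [TopologicalSpace F] [IsNonarchimedeanLocalField F]
    [Algebra E F]

lemma algebraMap_mem_valGE_zero [ValuativeExtension E F] {e : E} :
    algebraMap E F e ∈ valGE F 0 ↔ e ∈ valGE E 0 := by
  rw [← mem_integer_iff, ← mem_integer_iff, Valuation.mem_integer_iff, Valuation.mem_integer_iff,
    ← Valuation.vle_one_iff, ← Valuation.vle_one_iff, ← map_one (algebraMap E F),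
    ValuativeExtension.vle_iff_vle]

lemma val_zpow {K : Type*} [Field K] [ValuativeRel K] [TopologicalSpace K]
    [IsNonarchimedeanLocalField K] (x : K) (n : ℤ) : val K (x ^ n) = n * val K x := by
  simp [val]

lemma val_algebraMap_of_val_eq_zero [ValuativeExtension E F] {e : E} (he : val E e = 0) :
    val F (algebraMap E F e) = 0 := by
  by_cases he0 : e = 0
  · simp [he0]
  have hF : algebraMap E F e ≠ 0 := by simpa using he0
  have h1 := (mem_valGE hF).1 (algebraMap_mem_valGE_zero.2 (mem_valGE_of_val he.ge))
  have h2 := algebraMap_mem_valGE_zero (F := F).2 (inv_mem_valGE (x := e) (n := 0) (by omega))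
  rw [map_inv₀, mem_valGE (inv_ne_zero hF), val_inv] at h2
  omega

variable (hFE : IsWildlyRamifiedQuadratic E F)
include hFE

lemma val_algebraMap [ValuativeExtension E F] (e : E) :
    val F (algebraMap E F e) = 2 * val E e := by
  by_cases he0 : e = 0
  · simp [he0]
  obtain ⟨π, hπ0, hπ⟩ := exists_val_eq (K := E) 1
  have hπF := hFE.totallyRamified π hπ
  rw [hFE.finrank_eq_two] at hπF
  have hz : π ^ (val E e) ≠ 0 := zpow_ne_zero _ hπ0
  have hu : val E (e / π ^ (val E e)) = 0 := by
    rw [val_div he0 hz, val_zpow, hπ]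
    omega
  have h1 := val_algebraMap_of_val_eq_zero (F := F) hu
  rw [map_div₀, map_zpow₀, val_div (by simpa using he0) (zpow_ne_zero _ (by simpa using hπ0)),
    val_zpow, hπF] at h1
  push_cast at h1
  omega

lemma algebraMap_mem_valGE [ValuativeExtension E F] {e : E} {n : ℤ} :
    algebraMap E F e ∈ valGE F (2 * n) ↔ e ∈ valGE E n := by
  by_cases he0 : e = 0
  · simp [he0, zero_mem]
  rw [mem_valGE he0, mem_valGE (by simpa using he0), val_algebraMap hFE]
  omega

/-- If 1 and `ϖ` were dependent, `ϖ` would lie in `E` and have even valuation. -/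
lemma exists_eq_add_mul_unif [ValuativeExtension E F] {ϖ : F} (hϖ : val F ϖ = 1) (x : F) :
    ∃ a b : E, x = algebraMap E F a + algebraMap E F b * ϖ := by
  have hli : LinearIndependent E ![1, ϖ] := by
    rw [LinearIndependent.pair_iff]
    intro a b hab
    rw [Algebra.smul_def, Algebra.smul_def, mul_one] at hab
    have hb : b = 0 := by
      by_contra hb
      have hbF : algebraMap E F b ≠ 0 := by simpa using hb
      have h1 : ϖ = algebraMap E F (-a / b) := by
        rw [map_div₀, map_neg, eq_div_iff hbF]
        linear_combination hab
      rw [h1, val_algebraMap hFE] at hϖ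
      omega
    exact ⟨by simpa [hb] using hab, hb⟩
  have hspan := hli.span_eq_top_of_card_eq_finrank (by simp [hFE.finrank_eq_two])
  have hx : x ∈ Submodule.span E (Set.range ![1, ϖ]) := hspan ▸ Submodule.mem_top
  rw [Matrix.range_cons, Matrix.range_cons, Matrix.range_empty, Set.union_empty,
    Set.singleton_union, Submodule.mem_span_pair] at hx
  obtain ⟨a, b, rfl⟩ := hx
  exact ⟨a, b, by rw [Algebra.smul_def, Algebra.smul_def, mul_one]⟩

variable {σ : F ≃ₐ[E] F} (hσ : σ ≠ 1)
include hσ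

omit [ValuativeRel E] [TopologicalSpace E] [IsNonarchimedeanLocalField E] [ValuativeRel F]
  [TopologicalSpace F] [IsNonarchimedeanLocalField F] hFE in
lemma card_aut_of_finrank_eq_two (hrank : Module.finrank E F = 2) :
    Nat.card (F ≃ₐ[E] F) = 2 ∧ ∀ τ : F ≃ₐ[E] F, τ = 1 ∨ τ = σ := by
  classical
  have : FiniteDimensional E F := Module.finite_of_finrank_pos (by omega)
  have hle : Fintype.card (F ≃ₐ[E] F) ≤ 2 := hrank ▸ AlgEquiv.card_le
  have hpair : ({1, σ} : Finset (F ≃ₐ[E] F)).card = 2 := Finset.card_pair hσ.symm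
  have huniv : ({1, σ} : Finset (F ≃ₐ[E] F)) = Finset.univ :=
    Finset.eq_univ_of_card _ (le_antisymm (Finset.card_le_univ _) (by omega))
  refine ⟨by rw [Nat.card_eq_fintype_card, ← Finset.card_univ, ← huniv, hpair], fun τ ↦ ?_⟩
  have := Finset.mem_univ τ
  rw [← huniv] at this
  simpa using this

omit [ValuativeRel E] [TopologicalSpace E] [IsNonarchimedeanLocalField E] [ValuativeRel F]
  [TopologicalSpace F] [IsNonarchimedeanLocalField F] hFE in
lemma algebraMap_norm_of_finrank_eq_two (hrank : Module.finrank E F = 2) (x : F) :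
    algebraMap E F (Algebra.norm E x) = x * σ x := by
  classical
  have : FiniteDimensional E F := Module.finite_of_finrank_pos (by omega)
  obtain ⟨hcard, hall⟩ := card_aut_of_finrank_eq_two hσ hrank
  -- Separability enters through the nontrivial `σ`: there are as many automorphisms as the degree.
  have : IsGalois E F := IsGalois.of_card_aut_eq_finrank E F (by rw [hcard, hrank])
  have huniv : (Finset.univ : Finset (F ≃ₐ[E] F)) = {1, σ} := by
    ext τ
    simpa using hall τ
  rw [Algebra.norm_eq_prod_automorphisms, huniv, Finset.prod_pair hσ.symm]
  rfl

lemma isRamifiedInvolution [ValuativeExtension E F] {ϖ : F} (hϖ : val F ϖ = 1) :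
    IsRamifiedInvolution (σ : F ≃+* F) ϖ := by
  have hσ2 : σ * σ = 1 := by
    refine ((card_aut_of_finrank_eq_two hσ hFE.finrank_eq_two).2 (σ * σ)).resolve_right fun h ↦ ?_
    exact hσ (mul_eq_left.1 h)
  have hϖσ : σ ϖ ≠ ϖ := by
    intro hfix
    refine hσ (AlgEquiv.ext fun x ↦ ?_)
    obtain ⟨a, b, rfl⟩ := exists_eq_add_mul_unif hFE hϖ x
    rw [map_add, map_mul, hfix, AlgEquiv.commutes, AlgEquiv.commutes, AlgEquiv.one_apply]
  refine ⟨fun x ↦ ?_, fun x hx ↦ ?_, fun x ↦ ?_, hϖ, ?_⟩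
  · exact DFunLike.congr_fun hσ2 x
  · obtain ⟨a, b, rfl⟩ := exists_eq_add_mul_unif hFE hϖ x
    have hx' : σ (algebraMap E F a + algebraMap E F b * ϖ)
      = algebraMap E F a + algebraMap E F b * ϖ := hx
    rw [map_add, map_mul, AlgEquiv.commutes, AlgEquiv.commutes, add_right_inj] at hx'
    have hb : algebraMap E F b = 0 := by
      by_contra hb
      exact hϖσ (mul_left_cancel₀ hb hx')
    rw [hb, zero_mul, add_zero, val_algebraMap hFE]
    exact even_two_mul _
  · obtain ⟨a, b, hx⟩ := exists_eq_add_mul_unif hFE hϖ x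
    exact ⟨_, _, σ.commutes a, σ.commutes b, hx⟩
  · have := hFE.charP_residueField
    have h2 : (2 : E) ∈ valGE E 1 := by
      have h0 : (1 + 1 : E) ∈ valGE E 0 := add_mem one_mem_valGE one_mem_valGE
      rw [← one_add_one_eq_two, ← red_eq_zero_iff h0, red_add one_mem_valGE one_mem_valGE, red_one]
      exact CharTwo.add_self_eq_zero 1
    have h3 := (algebraMap_mem_valGE (F := F) hFE).2 h2
    rw [map_ofNat] at h3
    exact valGE_anti (by norm_num) h3

variable {χ : Eˣ →* ℂˣ} (hχ : IsNormCharacter E F χ)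
include hχ

lemma character_eq_one_of_norm {c : Eˣ}
    (hc : ∃ x ∈ valGE F 0, x * σ x = algebraMap E F c) : χ c = 1 := by
  have hrank := hFE.finrank_eq_two
  obtain ⟨x, -, hx⟩ := hc
  rw [← algebraMap_norm_of_finrank_eq_two hσ hrank, (algebraMap E F).injective.eq_iff] at hx
  have hx0 : x ≠ 0 := by
    rintro rfl
    have : FiniteDimensional E F := Module.finite_of_finrank_pos (by omega)
    rw [Algebra.norm_zero] at hx
    exact c.ne_zero hx.symm
  rw [← hχ.2 (Units.mk0 x hx0)]
  exact congrArg χ (Units.ext hx.symm)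

/-- The norm of `ϖ` is a uniformizer of `E` on which χ is trivial, so dividing by its powers moves
any element with χ ≠ 1 to a unit. -/
lemma exists_unit_character_ne_one [ValuativeExtension E F] {ϖ : F} (hϖ : val F ϖ = 1) :
    ∃ c : Eˣ, val E (c : E) = 0 ∧ χ c ≠ 1 := by
  have h := isRamifiedInvolution hFE hσ hϖ
  have hex : ∃ e, χ e ≠ 1 := by
    by_contra! hall
    exact hχ.1 (MonoidHom.ext hall)
  obtain ⟨e, he⟩ := hex
  let p : Eˣ := Units.map (Algebra.norm E : F →* E) (Units.mk0 ϖ h.unif_ne_zero)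
  have hp : val E (p : E) = 1 := by
    have h1 := val_algebraMap hFE (p : E)
    have h2 : algebraMap E F p = ϖ * σ ϖ :=
      algebraMap_norm_of_finrank_eq_two hσ hFE.finrank_eq_two ϖ
    have h3 : val F (ϖ * σ ϖ) = 2 := h.val_norm_unif
    rw [h2, h3] at h1
    omega
  refine ⟨e / p ^ (val E (e : E)), ?_, ?_⟩
  · rw [Units.val_div_eq_div_val, Units.val_zpow_eq_zpow_val,
      val_div e.ne_zero (zpow_ne_zero _ p.ne_zero), val_zpow, hp, mul_one, sub_self]
  · rw [map_div, map_zpow, hχ.2 _, one_zpow, div_one]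
    exact he

/-- On units, a nontrivial character of the norm class group is `1` on norms and `-1` on the other
elements. -/
lemma character_eq_neg_one [ValuativeExtension E F] {ϖ : F} (hϖ : val F ϖ = 1) {s : ℕ}
    (hs : val F (σ ϖ * ϖ⁻¹ - 1) = s) {c : Eˣ} (hc : val E (c : E) = 0)
    (hcn : ¬ ∃ x ∈ valGE F 0, x * σ x = algebraMap E F c) : χ c = -1 := by
  have h := isRamifiedInvolution hFE hσ hϖ
  obtain ⟨d, hd, hdχ⟩ := exists_unit_character_ne_one hFE hσ hχ hϖ
  have hdn : ¬ ∃ x ∈ valGE F 0, x * σ x = algebraMap E F d := fun hdn ↦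
    hdχ (character_eq_one_of_norm hFE hσ hχ hdn)
  have hmul : ∀ {a b : Eˣ}, val E (a : E) = 0 → val E (b : E) = 0 →
      (¬ ∃ x ∈ valGE F 0, x * σ x = algebraMap E F a) →
      (¬ ∃ x ∈ valGE F 0, x * σ x = algebraMap E F b) → χ a * χ b = 1 := by
    intro a b ha hb han hbn
    rw [← map_mul]
    refine character_eq_one_of_norm hFE hσ hχ ?_
    rw [Units.val_mul, map_mul]
    exact h.exists_norm_eq_mul hs (σ.commutes a) (by simp) (val_algebraMap_of_val_eq_zero ha)
      (σ.commutes b) (by simp) (val_algebraMap_of_val_eq_zero hb) han hbn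
  have hdd := hmul hd hd hdn hdn
  have hcd := hmul hc hd hcn hdn
  have hd1 : χ d = -1 := by
    have hdd' : (χ d : ℂ) * χ d = 1 := congrArg Units.val hdd
    refine Units.ext ((mul_self_eq_one_iff.1 hdd').resolve_left fun h1 ↦ hdχ (Units.ext h1))
  rw [hd1, mul_neg, mul_one] at hcd
  rw [← hcd, neg_neg]

variable [MeasurableSpace F] [BorelSpace F]
  (μ : Measure F) [μ.IsAddHaarMeasure] (hμ : μ (𝒪[F] : Set F) = 1)
include hμ

/-- The measure of the set of integral elements with norm close to a given unit. -/
lemma measureReal_normFiber [ValuativeExtension E F] {ϖ : F} (hϖ : val F ϖ = 1) {s : ℕ}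
    (hs : val F (σ ϖ * ϖ⁻¹ - 1) = s) {c : Eˣ} (hc : val E (c : E) = 0) (n : ℕ) :
    ((resCard F : ℂ) ^ n * μ.real (normFiber (σ : F ≃+* F) n (algebraMap E F c)) : ℂ)
      = if n ≤ s then (1 : ℂ) else 1 + (χ c : ℂ) := by
  have h := isRamifiedInvolution hFE hσ hϖ
  have hcF := val_algebraMap_of_val_eq_zero (F := F) hc
  have hc0 : algebraMap E F c ≠ 0 := by simp
  have hreal : ∀ k : ℕ, (Nat.card 𝓀[F] : ENNReal) ^ n
      * μ (normFiber (σ : F ≃+* F) n (algebraMap E F c)) = k →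
      ((resCard F : ℂ) ^ n * μ.real (normFiber (σ : F ≃+* F) n (algebraMap E F c)) : ℂ) = k := by
    intro k hk
    have := congrArg ENNReal.toReal hk
    rw [ENNReal.toReal_mul, ENNReal.toReal_pow, ENNReal.toReal_natCast,
      ENNReal.toReal_natCast] at this
    exact_mod_cast this
  split_ifs with hn
  · simpa using hreal 1 (by
      simpa using h.measure_normFiber_of_le μ hμ hs hn (σ.commutes c) hc0 hcF)
  push Not at hn
  by_cases hcn : ∃ x ∈ valGE F 0, x * σ x = algebraMap E F c
  · obtain ⟨d, hd, hdχ⟩ := exists_unit_character_ne_one hFE hσ hχ hϖ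
    have hdn : ¬ ∃ x ∈ valGE F 0, x * σ x = algebraMap E F d := fun hdn ↦
      hdχ (character_eq_one_of_norm hFE hσ hχ hdn)
    have := hreal 2 (by
      simpa using h.measure_normFiber_of_lt μ hμ hs hn (σ.commutes c) hc0 hcF hcn (σ.commutes d)
        (by simp) (val_algebraMap_of_val_eq_zero hd) hdn)
    rw [this, character_eq_one_of_norm hFE hσ hχ hcn]
    norm_num
  · rw [character_eq_neg_one hFE hσ hχ hϖ hs hc hcn,
      h.normFiber_eq_empty hs hn (σ.commutes c) hc0 hcF hcn]
    simp

end Extension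

/-! ### Integration over the layers and summation of the series -/

open Filter in
/-- The integral of a function which is `z ^ n` on the `n`-th difference set of a decreasing sequence
of sets with null intersection. -/
lemma integral_pow_of_antitone {X : Type*} [MeasurableSpace X] {μ : Measure X} {A : ℕ → Set X}
    (hA : Antitone A) (hm : ∀ n, MeasurableSet (A n)) (hfin : μ (A 0) ≠ ⊤)
    (hlim : Tendsto (fun n ↦ μ.real (A n)) atTop (nhds 0)) {f : X → ℂ} {z : ℂ}
    (hf : ∀ n, ∀ x ∈ A n \ A (n + 1), f x = z ^ n)
    (hsum : Summable fun n ↦ ‖z‖ ^ n * (μ.real (A n) - μ.real (A (n + 1)))) :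
    IntegrableOn f (A 0) μ ∧
      HasSum (fun n ↦ z ^ n * (μ.real (A n) - μ.real (A (n + 1)) : ℂ)) (∫ x in A 0, f x ∂μ) := by
  have hfin' : ∀ n, μ (A n) ≠ ⊤ := fun n ↦ measure_ne_top_of_subset (hA (Nat.zero_le n)) hfin
  set D : ℕ → Set X := fun n ↦ A n \ A (n + 1) with hD
  have hDm : ∀ n, MeasurableSet (D n) := fun n ↦ (hm n).diff (hm _)
  have hDfin : ∀ n, μ (D n) ≠ ⊤ := fun n ↦ measure_ne_top_of_subset Set.sdiff_subset (hfin' n)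
  have hDμ : ∀ n, μ.real (D n) = μ.real (A n) - μ.real (A (n + 1)) := fun n ↦
    measureReal_sdiff (hA n.le_succ) (hm _) (hfin' n)
  have hdisj : Pairwise (Function.onFun Disjoint D) := by
    have key : ∀ m n, m < n → Disjoint (D m) (D n) := fun m n hmn ↦
      Set.disjoint_left.2 fun x hx hx' ↦ hx.2 (hA hmn hx'.1)
    intro m n hmn
    rcases lt_or_gt_of_ne hmn with hlt | hlt
    · exact key m n hlt
    · exact (key n m hlt).symm
  -- Nothing is known about `f` here; in the application this is the zero set of η + N(x).
  have hnull : μ (⋂ n, A n) = 0 := by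
    rw [← measureReal_eq_zero_iff (measure_ne_top_of_subset (Set.iInter_subset _ 0) hfin)]
    refine le_antisymm (ge_of_tendsto' hlim fun n ↦ ?_) measureReal_nonneg
    exact measureReal_mono (Set.iInter_subset _ n) (hfin' n)
  have hU : A 0 = (⋃ n, D n) ∪ ⋂ n, A n := by
    classical
    ext x
    simp only [Set.mem_union, Set.mem_iUnion, Set.mem_iInter]
    constructor
    · intro hx
      by_cases hall : ∀ n, x ∈ A n
      · exact Or.inr hall
      · left
        push Not at hall
        have h0 : Nat.find hall ≠ 0 := fun h0 ↦ Nat.find_spec hall (h0 ▸ hx)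
        obtain ⟨k, hk⟩ := Nat.exists_eq_succ_of_ne_zero h0
        refine ⟨k, ?_, ?_⟩
        · by_contra hxk
          exact Nat.find_min hall (m := k) (by omega) hxk
        · have := Nat.find_spec hall
          rwa [hk] at this
    · rintro (⟨n, hn⟩ | hx)
      · exact hA (Nat.zero_le n) hn.1
      · exact hx 0
  have hae : A 0 =ᵐ[μ] ⋃ n, D n := by
    rw [hU]
    exact union_ae_eq_left_of_ae_eq_empty (ae_eq_empty.2 hnull)
  have hconst : ∀ n, IntegrableOn f (D n) μ := fun n ↦
    (integrableOn_congr_fun (hf n) (hDm n)).2 (integrableOn_const (hDfin n))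
  have hint : IntegrableOn f (⋃ n, D n) μ := by
    refine integrableOn_iUnion_of_summable_integral_norm hconst (hsum.congr fun n ↦ ?_)
    rw [setIntegral_congr_fun (g := fun _ ↦ ‖z‖ ^ n) (hDm n)
      (fun x hx ↦ by simp only [hf n x hx, norm_pow]), setIntegral_const, hDμ, smul_eq_mul,
      mul_comm]
  refine ⟨hint.congr_set_ae hae, ?_⟩
  rw [setIntegral_congr_set hae]
  have hterm : ∀ n, ∫ x in D n, f x ∂μ = z ^ n * (μ.real (A n) - μ.real (A (n + 1)) : ℂ) := by
    intro n
    rw [setIntegral_congr_fun (hDm n) (hf n), setIntegral_const, hDμ, Complex.real_smul, mul_comm,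
      Complex.ofReal_sub]
  have hmain := hasSum_integral_iUnion hDm hdisj hint
  simp only [hterm] at hmain
  exact hmain

/-- The generating series of a sequence that drops geometrically, with a correction after `s`. -/
lemma hasSum_break {u q x : ℂ} (hu : ‖u‖ < 1) (hq : q ≠ 0) (s : ℕ) {m : ℕ → ℂ}
    (hm : ∀ n, q ^ n * m n = if n ≤ s then 1 else 1 + x) :
    HasSum (fun n ↦ (u * q) ^ n * (m n - m (n + 1)))
      ((1 - 1 / q + x * u ^ s * (u - 1 / q)) / (1 - u)) := by
  have hu1 : 1 - u ≠ 0 := by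
    intro h0
    rw [sub_eq_zero] at h0
    rw [← h0] at hu
    simp at hu
  have hgeo := hasSum_geometric_of_norm_lt_one hu
  have hterm : ∀ n, (u * q) ^ n * (m n - m (n + 1))
      = u ^ n * (q ^ n * m n) - u ^ n / q * (q ^ (n + 1) * m (n + 1)) := by
    intro n
    field_simp
    ring
  -- Removing the series for x = 0 leaves zero before s, one boundary term at s, and a geometric
  -- tail.
  set g : ℕ → ℂ := fun n ↦ (u * q) ^ n * (m n - m (n + 1)) - (1 - 1 / q) * u ^ n with hg
  have hg_lt : ∀ n < s, g n = 0 := by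
    intro n hn
    rw [hg]
    simp only
    rw [hterm, hm, hm, if_pos (by omega), if_pos (by omega)]
    ring
  have hg_eq : g s = - (x * u ^ s / q) := by
    rw [hg]
    simp only
    rw [hterm, hm, hm, if_pos le_rfl, if_neg (by omega)]
    ring
  have hg_gt : ∀ n, g (n + (s + 1)) = x * (1 - 1 / q) * u ^ (s + 1) * u ^ n := by
    intro n
    rw [hg]
    simp only
    rw [hterm, hm, hm, if_neg (by omega), if_neg (by omega)]
    ring
  have hsum : HasSum g (x * (1 - 1 / q) * u ^ (s + 1) * (1 - u)⁻¹ + -(x * u ^ s / q)) := by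
    have h1 : HasSum (fun n ↦ g (n + (s + 1))) (x * (1 - 1 / q) * u ^ (s + 1) * (1 - u)⁻¹) := by
      simp only [hg_gt]
      exact hgeo.mul_left _
    rw [hasSum_nat_add_iff] at h1
    rwa [Finset.sum_range_succ, Finset.sum_eq_zero fun n hn ↦ hg_lt n (Finset.mem_range.1 hn),
      zero_add, hg_eq] at h1
  have := hsum.add (hgeo.mul_left (1 - 1 / q))
  simp only [hg, sub_add_cancel] at this
  convert this using 1
  field_simp
  ring

end LocalFieldIntegral

end

/-! ### The integral formula -/

open LocalFieldIntegral in
theorem lemma4p6 {E F : Type*}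
    [Field E] [ValuativeRel E] [TopologicalSpace E] [IsNonarchimedeanLocalField E]
    [Field F] [ValuativeRel F] [TopologicalSpace F] [IsNonarchimedeanLocalField F]
    [Algebra E F] [ValuativeExtension E F]
    (hFE : LocalFieldIntegral.IsWildlyRamifiedQuadratic E F)
    [MeasurableSpace F] [BorelSpace F]
    (μ : Measure F) [μ.IsAddHaarMeasure] (hμ : μ (𝒪[F] : Set F) = 1)
    (σ : F ≃ₐ[E] F) (hσ : σ ≠ 1)
    (ϖ : F) (hϖ : LocalFieldIntegral.val F ϖ = 1)
    (s : ℤ) (hs : s = LocalFieldIntegral.val F (σ ϖ * ϖ⁻¹ - 1))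
    (q : ℕ) (hq : q = LocalFieldIntegral.resCard F)
    (χ : Eˣ →* ℂˣ) (hχ : LocalFieldIntegral.IsNormCharacter E F χ)
    (η : Eˣ) (hη : LocalFieldIntegral.val E (η : E) = 0)
    (z₁ z₂ s₁ : ℂ) (hs₁ : s₁ = -z₁ + z₂ - 1 / 2) (hre : -(1 / 2 : ℝ) < s₁.re) :
    IntegrableOn (fun x : F ↦
        ((LocalFieldIntegral.absVal F (algebraMap E F ((η : E) + Algebra.norm E x)) : ℝ) : ℂ) ^ s₁)
      (𝒪[F] : Set F) μ ∧
    ∫ x in (𝒪[F] : Set F),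
        ((LocalFieldIntegral.absVal F (algebraMap E F ((η : E) + Algebra.norm E x)) : ℝ) : ℂ) ^ s₁ ∂μ
      = ((q : ℂ) ^ (2 * z₂) - (q : ℂ) ^ (2 * z₂ - 1)
          + (χ (-η) : ℂ) * ((q : ℂ) ^ ((s : ℂ) * (2 * z₁ - 2 * z₂) + 2 * z₁)
              - (q : ℂ) ^ ((2 * z₁ - 2 * z₂) * (s : ℂ) + 2 * z₂ - 1)))
        / ((q : ℂ) ^ (2 * z₂) - (q : ℂ) ^ (2 * z₁)) := by

  subst hq
  have h := isRamifiedInvolution hFE hσ hϖ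
  have hq1 : 1 < resCard F := Finite.one_lt_card
  set q := resCard F with hq
  have hq0 : (q : ℂ) ≠ 0 := by exact_mod_cast (by omega : q ≠ 0)
  have hqR : (0 : ℝ) < q := by exact_mod_cast (by omega : 0 < q)
  have hmemσ : σ ϖ * ϖ⁻¹ - 1 ∈ valGE F 0 := by
    have h1 : σ ϖ ∈ valGE F 1 := h.conj_mem (hϖ ▸ self_mem_valGE ϖ)
    have h2 := mul_mem_valGE h1 (inv_mem_valGE (x := ϖ) (n := -1) (by omega))
    exact sub_mem (by simpa using h2) one_mem_valGE
  obtain ⟨S, rfl⟩ := Int.eq_ofNat_of_zero_le (hs ▸ (mem_valGE h.break_ne_zero).1 hmemσ)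
  replace hs := hs.symm
  have hη' : val E ((-η : Eˣ) : E) = 0 := by rw [Units.val_neg, val_neg, hη]
  set A : ℕ → Set F := fun n ↦ normFiber (σ : F ≃+* F) n (algebraMap E F (-η : Eˣ)) with hA
  have hm : ∀ n, (q : ℂ) ^ n * (μ.real (A n) : ℂ)
      = if n ≤ S then (1 : ℂ) else 1 + (χ (-η) : ℂ) := fun n ↦
    measureReal_normFiber hFE hσ hχ μ hμ hϖ hs hη' n
  have hA0 : A 0 = (𝒪[F] : Set F) := by
    rw [coe_integer_eq]
    exact IsRamifiedInvolution.normFiber_zero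
      (mem_valGE_of_val (val_algebraMap_of_val_eq_zero hη').ge) fun x hx ↦ h.conj_mem hx
  set u : ℂ := (q : ℂ) ^ (2 * z₁ - 2 * z₂) with hu_def
  have hu : ‖u‖ < 1 := by
    rw [hu_def, Complex.norm_natCast_cpow_of_pos (by omega)]
    refine Real.rpow_lt_one_of_one_lt_of_neg (by exact_mod_cast hq1) ?_
    have : 2 * z₁ - 2 * z₂ = -2 * s₁ - 1 := by rw [hs₁]; ring
    rw [this]
    simp only [Complex.sub_re, Complex.mul_re, Complex.neg_re, Complex.neg_im, Complex.one_re,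
      Complex.re_ofNat, Complex.im_ofNat]
    linarith
  have hanti : Antitone A := fun m n hmn ↦ IsRamifiedInvolution.normFiber_anti hmn _
  have hlim : Filter.Tendsto (fun n ↦ μ.real (A n)) Filter.atTop (nhds 0) := by
    have h1 : Filter.Tendsto (fun n : ℕ ↦ (1 + (χ (-η) : ℂ)) * ((q : ℂ)⁻¹) ^ n) Filter.atTop
        (nhds ((1 + (χ (-η) : ℂ)) * 0)) := by
      refine (tendsto_pow_atTop_nhds_zero_of_norm_lt_one ?_).const_mul _
      rw [norm_inv, Complex.norm_natCast]
      exact inv_lt_one_of_one_lt₀ (by exact_mod_cast hq1)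
    rw [mul_zero] at h1
    have h2 : Filter.Tendsto (fun n ↦ (μ.real (A n) : ℂ)) Filter.atTop (nhds 0) := by
      refine h1.congr' ?_
      filter_upwards [Filter.eventually_gt_atTop S] with n hn
      have := hm n
      rw [if_neg (by omega)] at this
      rw [← this, inv_pow, mul_comm ((q : ℂ) ^ n), mul_assoc,
        mul_inv_cancel₀ (pow_ne_zero _ hq0), mul_one]
    refine Filter.tendsto_ofReal_iff.1 ?_
    rwa [Complex.ofReal_zero]
  have hf : ∀ n, ∀ x ∈ A n \ A (n + 1),
      ((absVal F (algebraMap E F ((η : E) + Algebra.norm E x)) : ℝ) : ℂ) ^ s₁ = (u * q) ^ n := by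
    rintro n x ⟨hx, hx'⟩
    rw [hA] at hx hx'
    simp only [IsRamifiedInvolution.mem_normFiber] at hx hx'
    set e : E := (η : E) + Algebra.norm E x with he
    have hxe : x * (σ : F ≃+* F) x - algebraMap E F (-η : Eˣ) = algebraMap E F e := by
      rw [he, map_add, algebraMap_norm_of_finrank_eq_two hσ hFE.finrank_eq_two, Units.val_neg,
        map_neg, sub_neg_eq_add, add_comm]
      rfl
    rw [hxe, algebraMap_mem_valGE hFE] at hx hx'
    have he0 : e ≠ 0 := by
      intro he0
      exact hx' ⟨hx.1, he0 ▸ zero_mem _⟩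
    have hle := (mem_valGE he0).1 hx.2
    have hlt : ¬ ((n + 1 : ℕ) : ℤ) ≤ val E e := fun hle ↦ hx' ⟨hx.1, (mem_valGE he0).2 hle⟩
    have hval : val E e = n := by push_cast at hlt; omega
    -- The exponent is doubled because the absolute value is that of `F` while `e` lies in `E`.
    have habs : absVal F (algebraMap E F e) = (q : ℝ) ^ (-(2 * n : ℤ)) := by
      rw [absVal, if_neg (by simpa using he0), val_algebraMap hFE, hval]
    have hpos : (0 : ℝ) < (q : ℝ) ^ (-(2 * n : ℤ)) := zpow_pos hqR _
    rw [habs, Complex.cpow_def_of_ne_zero (by exact_mod_cast hpos.ne'), ← Complex.ofReal_log hpos.le,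
      Real.log_zpow]
    have huq : u * q = (q : ℂ) ^ (2 * z₁ - 2 * z₂ + 1) := by
      rw [Complex.cpow_add _ _ hq0, Complex.cpow_one]
    rw [huq, ← Complex.cpow_nat_mul,
      Complex.cpow_def_of_ne_zero hq0, ← Complex.natCast_log, hs₁]
    congr 1
    push_cast
    ring
  have hsum : Summable fun n ↦ ‖u * q‖ ^ n * (μ.real (A n) - μ.real (A (n + 1))) := by
    -- Absolute convergence is the same series with u replaced by its norm.
    have h1 := (hasSum_break (u := (‖u‖ : ℂ)) (by simpa using hu) hq0 S hm).summable
    have h2 : ‖u * q‖ = ‖u‖ * q := by rw [norm_mul, Complex.norm_natCast]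
    rw [h2]
    exact_mod_cast h1
  have hmain := integral_pow_of_antitone hanti (fun n ↦ h.measurableSet_normFiber _ _)
    (by rw [hA0, hμ]; exact ENNReal.one_ne_top) hlim hf hsum
  rw [hA0] at hmain
  refine ⟨hmain.1, ?_⟩
  rw [hmain.2.unique (hasSum_break hu hq0 S hm)]
  have hu1 : 1 - u ≠ 0 := by
    intro h0
    rw [sub_eq_zero] at h0
    rw [← h0] at hu
    simp at hu
  have ha0 : (q : ℂ) ^ (2 * z₂) ≠ 0 := by simp [Complex.cpow_eq_zero_iff, hq0]
  have hz₁ : (q : ℂ) ^ (2 * z₁) = u * (q : ℂ) ^ (2 * z₂) := by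
    rw [hu_def, ← Complex.cpow_add _ _ hq0, sub_add_cancel]
  have hden : (q : ℂ) ^ (2 * z₂) - (q : ℂ) ^ (2 * z₁) = (q : ℂ) ^ (2 * z₂) * (1 - u) := by
    rw [hz₁]; ring
  have hcast : (((S : ℕ) : ℤ) : ℂ) = (S : ℂ) := Int.cast_natCast S
  rw [hden, hcast, mul_comm (2 * z₁ - 2 * z₂), add_sub_assoc,
    Complex.cpow_add _ _ hq0, Complex.cpow_add _ _ hq0, Complex.cpow_nat_mul, ← hu_def,
    Complex.cpow_sub _ _ hq0, Complex.cpow_one, hz₁]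
  field_simp
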